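/- **Theorem 4.1.** Notation. For a finite real sequence $s=(s_0,\dots,s_{2n-2})$ let $A_s=(s_{i+j})_{i,j=0}^{n-1}$ be its Hankel matrix, with columns $\mathbf v_0,\dots,\mathbf v_{n-1}$. Put $\operatorname{rank} s=n$ if $A_s$ is nonsingular, and otherwise $\operatorname{rank} s=\min\{i : \mathbf v_i\in\operatorname{span}\{\mathbf v_0,\dots,\mathbf v_{i-1}\}\}$. A representing measure for $(s_0,\dots,s_d)$ is a positive Borel measure $\mu$ on $\mathbb R$ with $s_i=\int t^i\,d\mu(t)$ (all these integrals being finite) for $0\le i\le d$. It is $r$-atomic if it is a combination, with positive coefficients, of point masses at exactly $r$ distinct points. A partial symmetric matrix is partially positive semidefinite if all its fully specified principal submatrices are positive semidefinite. Let $k\in\mathbb N$, $k>1$, and let $\beta(x)=(\beta_0,x,\beta_2,\dots,\beta_{2k})$, where the $\beta_i$ are real numbers, $\beta_0>0$ and $x$ is a variable (so the entries of $A_{\beta(x)}$ equal to $x$ are unspecified). Put $$\widehat\beta=(\beta_2,\dots,\beta_{2k-2}),\quad \widetilde\beta=(\beta_2,\dots,\beta_{2k}),\quad \overline\beta=(\beta_4,\dots,\beta_{2k-2}),\quad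 \breve\beta=(\beta_4,\dots,\beta_{2k}),$$ $$v=(\beta_2,\dots,\beta_{k-1}),\quad u=(\beta_2,\dots,\beta_k),\quad \widetilde A=\begin{pmatrix}\beta_0&v\\ v^T&A_{\overline\beta}\end{pmatrix},\quad \widehat A=\begin{pmatrix}\beta_0&u\\ u^T&A_{\breve\beta}\end{pmatrix}.$$ The following statements are equivalent: 1. There exist $x_0\in\mathbb R$ and a representing measure for $\beta(x_0)$. 2. There exist $x_0\in\mathbb R$ and a $(\operatorname{rank}\widetilde\beta)$-atomic or a $(\operatorname{rank}\widetilde\beta+1)$-atomic representing measure for $\beta(x_0)$. 3. $A_{\beta(x)}$ is partially positive semidefinite and one of the following conditions holds: - (a) $k=2$ and $A_{\widetilde\beta}\succ0$; or $k>2$, $A_{\widetilde\beta}\succ0$ and $\widetilde A\succ0$; - (b) $\operatorname{rank}A_{\widehat\beta}=\operatorname{rank}A_{\widetilde\beta}=\operatorname{rank}A_{\breve\beta}$. Moreover, suppose that there exist $x_0\in\mathbb R$ and a representing measure for $\beta(x_0)$. Then there is no $x_0\in\mathbb R$ for which $\beta(x_0)$ has a $(\operatorname{rank}\widetilde\beta)$-atomic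 representing measure if and only if (b) holds and $\operatorname{rank}A_{\widehat\beta}<\operatorname{rank}\widehat A$. -/

import Mathlib

open MeasureTheory

namespace HamburgerGap

/-- The Hankel matrix `(s_{i+j})_{0 ≤ i, j < n}` of the finite sequence
`(s_0, …, s_{2n-2})`. The number `n` is the size of the matrix, and entries of `s`
beyond `2n-2` play no role. For `n = 0` the matrix is empty. -/
def hankel (s : ℕ → ℝ) (n : ℕ) : Matrix (Fin n) (Fin n) ℝ :=
  Matrix.of fun i j => s ((i : ℕ) + (j : ℕ))

/-- The rank of the finite sequence `s = (s_0, …, s_{2n-2})` with Hankel matrix `A_s` of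
size `n`, whose columns are `v_0, …, v_{n-1}`: it is `n` when `A_s` is nonsingular, and
otherwise the least `i < n` such that `v_i` lies in the span of `v_0, …, v_{i-1}`. -/
noncomputable def seqRank (s : ℕ → ℝ) (n : ℕ) : ℕ :=
  if (hankel s n).det ≠ 0 then n
  else sInf {i : ℕ | ∃ hi : i < n,
    (hankel s n).col ⟨i, hi⟩ ∈
      Submodule.span ℝ ((hankel s n).col '' {j : Fin n | (j : ℕ) < i})}

/-- `tail m s` is the sequence `(s_m, s_{m+1}, …)`. -/
def tail (m : ℕ) (s : ℕ → ℝ) : ℕ → ℝ := fun i => s (i + m)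

/-- The symmetric bordered matrix with corner entry `a`, border `v` and block `M`. -/
def bordered {n : ℕ} (a : ℝ) (v : Fin n → ℝ) (M : Matrix (Fin n) (Fin n) ℝ) :
    Matrix (Unit ⊕ Fin n) (Unit ⊕ Fin n) ℝ :=
  Matrix.fromBlocks (Matrix.of fun _ _ => a) (Matrix.replicateRow Unit v)
    (Matrix.replicateCol Unit v) M

/-- A partial real matrix (`none` marks an unspecified entry) is partially positive
semidefinite if it is symmetric, also in the positions of its specified entries, and each
of its fully specified principal submatrices is positive semidefinite. -/
def IsPartialPosSemidef {n : ℕ} (A : Matrix (Fin n) (Fin n) (Option ℝ)) : Prop :=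
  A.IsSymm ∧
    ∀ (S : Set (Fin n)) (B : Matrix S S ℝ),
      (∀ i j : S, A i j = some (B i j)) → B.PosSemidef

/-- The sequence `(s_0, ?, s_2, s_3, …)` whose term of index one is unspecified. -/
def gapOne (s : ℕ → ℝ) : ℕ → Option ℝ := fun i => if i = 1 then none else some (s i)

/-- The partial Hankel matrix of size `n` of the sequence `(s_0, ?, s_2, …, s_{2n-2})`. -/
def partialHankel (s : ℕ → ℝ) (n : ℕ) : Matrix (Fin n) (Fin n) (Option ℝ) :=
  Matrix.of fun i j => gapOne s ((i : ℕ) + (j : ℕ))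

/-- The sequence `(s_0, x, s_2, s_3, …)`, in which the term of index one is `x`. -/
def fillOne (s : ℕ → ℝ) (x : ℝ) : ℕ → ℝ := fun i => if i = 1 then x else s i

/-- `μ` is a representing measure on `ℝ` for the sequence `(s_0, …, s_d)`. -/
def IsRepresenting (μ : Measure ℝ) (s : ℕ → ℝ) (d : ℕ) : Prop :=
  ∀ i ≤ d, Integrable (fun t : ℝ => t ^ i) μ ∧ ∫ t, t ^ i ∂μ = s i

/-- `μ` is `r`-atomic: a combination of point masses at exactly `r` distinct points, with
positive densities. -/
def IsAtomic (μ : Measure ℝ) (r : ℕ) : Prop :=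
  ∃ (S : Finset ℝ) (w : ℝ → ℝ), S.card = r ∧ (∀ a ∈ S, 0 < w a) ∧
    μ = ∑ a ∈ S, ENNReal.ofReal (w a) • Measure.dirac a

/-- `A_{(β_2, …, β_{2k-2})}`, of size `k - 1`. -/
def hankelHat (β : ℕ → ℝ) (k : ℕ) : Matrix (Fin (k - 1)) (Fin (k - 1)) ℝ :=
  hankel (tail 2 β) (k - 1)

/-- `A_{(β_2, …, β_{2k})}`, of size `k`. -/
def hankelTilde (β : ℕ → ℝ) (k : ℕ) : Matrix (Fin k) (Fin k) ℝ :=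
  hankel (tail 2 β) k

/-- `A_{(β_4, …, β_{2k-2})}`, of size `k - 2`. -/
def hankelBar (β : ℕ → ℝ) (k : ℕ) : Matrix (Fin (k - 2)) (Fin (k - 2)) ℝ :=
  hankel (tail 4 β) (k - 2)

/-- `A_{(β_4, …, β_{2k})}`, of size `k - 1`. -/
def hankelBreve (β : ℕ → ℝ) (k : ℕ) : Matrix (Fin (k - 1)) (Fin (k - 1)) ℝ :=
  hankel (tail 4 β) (k - 1)

/-- The matrix with corner `β_0`, border `v = (β_2, …, β_{k-1})` and block
`A_{(β_4, …, β_{2k-2})}`. -/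
def matTilde (β : ℕ → ℝ) (k : ℕ) : Matrix (Unit ⊕ Fin (k - 2)) (Unit ⊕ Fin (k - 2)) ℝ :=
  bordered (β 0) (fun j => β ((j : ℕ) + 2)) (hankelBar β k)

/-- The matrix with corner `β_0`, border `u = (β_2, …, β_k)` and block
`A_{(β_4, …, β_{2k})}`. -/
def matHat (β : ℕ → ℝ) (k : ℕ) : Matrix (Unit ⊕ Fin (k - 1)) (Unit ⊕ Fin (k - 1)) ℝ :=
  bordered (β 0) (fun j => β ((j : ℕ) + 2)) (hankelBreve β k)

/-- The rank of the sequence `(β_2, …, β_{2k})`. -/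
noncomputable def rankTilde (β : ℕ → ℝ) (k : ℕ) : ℕ := seqRank (tail 2 β) k

/-- `rank A_{(β_2, …, β_{2k-2})} = rank A_{(β_2, …, β_{2k})} = rank A_{(β_4, …, β_{2k})}`. -/
def RanksAgree (β : ℕ → ℝ) (k : ℕ) : Prop :=
  (hankelHat β k).rank = (hankelTilde β k).rank ∧
    (hankelTilde β k).rank = (hankelBreve β k).rank

end HamburgerGap

namespace HamburgerGap

open Polynomial

/-! Write `L` for the functional with moments `β(x)`. Its only dependence on `x` is a multiple of
the linear coefficient of the argument, so the form `f, g ↦ L (f * g)` is independent of `x` on two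
spaces: the multiples of `X` (matrix `hankelTilde`) and the polynomials without linear term
(`matHat` and, one degree lower, `matTilde`). Partial positivity yields semidefiniteness on both. A
measure is then produced by Gaussian quadrature: a polynomial orthogonal to enough others, with
positivity below its degree, has simple real roots, and these are the nodes of a formula with
positive weights (`exists_quadrature`).

Positive definite case (`exists_quadrature_of_posDef`): projecting `1` and `X` off the multiples of
`X ^ 2` reduces the choice of `x` to a 2×2 Gram matrix whose off-diagonal entry is free. At each of
the two values of `x` making it singular, its kernel gives an orthogonal polynomial; the rule exists
as soon as this polynomial has full degree, and full degree cannot fail at both values.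

Singular case (`exists_quadrature_of_isotropic`): the rank equalities say that the isotropic
multiples `X * f` include one with `f` of top degree and one with `f` nonzero at `0`. The
least-degree such `p` is an orthogonal polynomial for `f ↦ L (X ^ 2 * f)`. Its quadrature nodes
avoid `0`, so dividing the weights by the squared nodes recovers `L` up to the moments of order zero
and one: the first is absorbed by `x`, the zeroth by a mass `m ≥ 0` at the origin. The rank
inequality in the last claim says exactly that this mass cannot be dispensed with.

Conversely, for a representing measure `L (f * f) = 0` means that `f` vanishes almost everywhere, a
property preserved by multiplication by `X`; this forces the stated alternatives
(`conditions_of_isRepresenting`). -/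

/-! ### Gaussian quadrature for a linear functional on polynomials -/

/-- If `p` is orthogonal to every polynomial and `p` is divisible by `(X - a)² + b²`, then
positivity below the degree of `p` is violated. -/
theorem not_sq_add_sq_dvd (L : ℝ[X] →ₗ[ℝ] ℝ) {p : ℝ[X]} {N : ℕ} (hp : p ≠ 0)
    (hN : 2 * p.natDegree ≤ N + 1)
    (horth : ∀ q : ℝ[X], (p * q).degree < N → L (p * q) = 0)
    (hpos : ∀ f : ℝ[X], f ≠ 0 → f.degree < p.natDegree → 0 < L (f * f)) (a b : ℝ) :
    ¬ ((X - C a) ^ 2 + C (b ^ 2)) ∣ p := by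
  rintro ⟨h, rfl⟩
  have hh : h ≠ 0 := right_ne_zero_of_mul hp
  set d : ℝ[X] := (X - C a) ^ 2 + C (b ^ 2) with hd
  have hdeg : d.natDegree = 2 := by rw [hd]; compute_degree!
  have hd0 : d ≠ 0 := left_ne_zero_of_mul hp
  have hnd : (d * h).natDegree = 2 + h.natDegree := by rw [natDegree_mul hd0 hh, hdeg]
  have hX : (X - C a : ℝ[X]) ≠ 0 := X_sub_C_ne_zero a
  have h0 : L (d * h * h) = 0 := by
    apply horth
    rw [degree_eq_natDegree (mul_ne_zero hp hh), natDegree_mul hp hh, hnd]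
    norm_cast; omega
  have h1 : 0 < L ((X - C a) * h * ((X - C a) * h)) := by
    apply hpos _ (mul_ne_zero hX hh)
    rw [degree_eq_natDegree (mul_ne_zero hX hh), natDegree_mul hX hh, natDegree_X_sub_C, hnd]
    norm_cast; omega
  have h2 : 0 < L (h * h) := by
    apply hpos _ hh
    rw [degree_eq_natDegree hh, hnd]
    norm_cast; omega
  -- The orthogonality relation `L (p * h) = 0` becomes a sum of a positive and a nonnegative term.
  have h3 : d * h * h = (X - C a) * h * ((X - C a) * h) + (b ^ 2) • (h * h) := by
    rw [hd, smul_eq_C_mul]; ring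
  rw [h3, map_add, map_smul, smul_eq_mul] at h0
  nlinarith [sq_nonneg b, mul_nonneg (sq_nonneg b) h2.le]

/-- A nonreal root yields a real factor `(X - a)² + b²` with `b ≠ 0`, and a multiple real root
yields the same factor with `b = 0`; one exclusion covers both. -/
theorem splits_and_nodup_roots (L : ℝ[X] →ₗ[ℝ] ℝ) {p : ℝ[X]} {N : ℕ} (hp : p ≠ 0)
    (hN : 2 * p.natDegree ≤ N + 1)
    (horth : ∀ q : ℝ[X], (p * q).degree < N → L (p * q) = 0)
    (hpos : ∀ f : ℝ[X], f ≠ 0 → f.degree < p.natDegree → 0 < L (f * f)) :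
    p.Splits ∧ p.roots.Nodup := by
  have key := not_sq_add_sq_dvd L hp hN horth hpos
  constructor
  · have hirr : ∀ g : ℝ[X], Irreducible g → g ∣ p → g.degree = 1 := ?_
    · obtain ⟨u, hu⟩ := UniqueFactorizationMonoid.factors_prod hp
      rw [← hu]
      refine (Splits.multisetProd fun g hg => ?_).mul u.isUnit.splits
      exact Splits.of_degree_eq_one (hirr g (UniqueFactorizationMonoid.irreducible_of_factor g hg)
        (UniqueFactorizationMonoid.dvd_of_mem_factors hg))
    intro g hg hgp
    obtain ⟨z, hz⟩ := IsAlgClosed.exists_aeval_eq_zero ℂ g (degree_pos_of_irreducible hg).ne'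
    by_cases him : z.im = 0
    · apply degree_eq_one_of_irreducible_of_root hg (x := z.re)
      have hz' : z = algebraMap ℝ ℂ z.re := by
        apply Complex.ext <;> simp [him]
      rw [hz', aeval_algebraMap_apply] at hz
      have : aeval z.re g = 0 := by
        simpa using hz
      simpa [IsRoot] using this
    · exfalso
      refine key z.re z.im (dvd_trans ?_ ((quadratic_dvd_of_aeval_eq_zero_im_ne_zero g hz him).trans
        hgp))
      refine dvd_of_eq ?_
      have : ‖z‖ ^ 2 = z.re ^ 2 + z.im ^ 2 := by
        rw [← Complex.normSq_eq_norm_sq, Complex.normSq_apply]; ring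
      rw [this]
      simp only [map_mul, map_add, map_pow, C_ofNat]
      ring
  · rw [Multiset.nodup_iff_count_le_one]
    intro a
    rw [count_roots]
    by_contra! h
    have h2 := (le_rootMultiplicity_iff hp).1 (show 2 ≤ p.rootMultiplicity a by omega)
    exact key a 0 (by simpa using h2)

/-- A Gaussian quadrature rule: the roots of an orthogonal polynomial are nodes of a quadrature
formula with positive weights. -/
theorem exists_quadrature (L : ℝ[X] →ₗ[ℝ] ℝ) {p : ℝ[X]} {N : ℕ} (hp : p ≠ 0)
    (hN : 2 * p.natDegree ≤ N + 1)
    (horth : ∀ q : ℝ[X], (p * q).degree < N → L (p * q) = 0)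
    (hpos : ∀ f : ℝ[X], f ≠ 0 → f.degree < p.natDegree → 0 < L (f * f)) :
    ∃ (S : Finset ℝ) (w : ℝ → ℝ), S.card = p.natDegree ∧ (∀ a ∈ S, 0 < w a) ∧
      (∀ a, a ∈ S ↔ p.IsRoot a) ∧
      ∀ f : ℝ[X], f.degree < N → L f = ∑ a ∈ S, w a * f.eval a := by
  obtain ⟨hs, hnd⟩ := splits_and_nodup_roots L hp hN horth hpos
  set S : Finset ℝ := p.roots.toFinset with hS
  have hcard : S.card = p.natDegree := by
    rw [hS, Multiset.toFinset_card_of_nodup hnd]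
    exact splits_iff_card_roots.1 hs
  have hmem : ∀ a, a ∈ S ↔ p.IsRoot a := fun a => by simp [hS, hp]
  have hdvd : ∀ f : ℝ[X], (∀ a ∈ S, f.eval a = 0) → p ∣ f := by
    intro f hf
    by_cases hf0 : f = 0
    · simp [hf0]
    · refine hs.dvd_of_roots_le_roots hp ((Multiset.le_iff_subset hnd).2 fun a ha => ?_)
      exact (mem_roots hf0).2 (hf a (Multiset.mem_toFinset.2 ha))
  have hinj : Set.InjOn (id : ℝ → ℝ) S := Function.injective_id.injOn
  have hdvdL : ∀ f : ℝ[X], f.degree < N → (∀ a ∈ S, f.eval a = 0) → L f = 0 := by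
    intro f hf h
    obtain ⟨q, rfl⟩ := hdvd f h
    exact horth q hf
  have hbdeg : ∀ a ∈ S, (Lagrange.basis S id a).degree = ((S.card - 1 : ℕ) : WithBot ℕ) :=
    fun a ha => Lagrange.degree_basis hinj ha
  have hself : ∀ a ∈ S, (Lagrange.basis S id a).eval a = 1 :=
    fun a ha => Lagrange.eval_basis_self hinj ha
  have hne : ∀ a b, b ∈ S → a ≠ b → (Lagrange.basis S id a).eval b = 0 :=
    fun a b hb hab => Lagrange.eval_basis_of_ne (v := id) hab hb
  refine ⟨S, fun a => L (Lagrange.basis S id a), hcard, ?_, hmem, ?_⟩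
  · intro a ha
    have hc : 0 < S.card := Finset.card_pos.2 ⟨a, ha⟩
    set l := Lagrange.basis S id a with hl
    have hl0 : l ≠ 0 := fun h => by
      have := hself a ha
      rw [← hl, h] at this
      simp at this
    have h1 : 0 < L (l * l) := hpos l hl0 (by
      rw [hbdeg a ha, ← hcard]; norm_cast; omega)
    -- `l * l - l` vanishes at every node, so the weight `L l` equals `L (l * l)`, which is
    -- positive.
    have h2 : L (l * l - l) = 0 := by
      apply hdvdL
      · refine (degree_sub_le _ _).trans_lt (max_lt ?_ ?_)
        · rw [degree_mul, hbdeg a ha]; norm_cast; omega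
        · rw [hbdeg a ha]; norm_cast; omega
      · intro b hb
        by_cases hab : a = b
        · subst hab; simp [hl, hself a ha]
        · simp [hl, hne a b hb hab]
    rw [map_sub, sub_eq_zero] at h2
    exact h1.trans_eq h2
  · intro f hf
    -- The difference between `f` and its Lagrange interpolant vanishes at all nodes, hence is
    -- annihilated by `L`.
    have h := hdvdL (f - ∑ a ∈ S, f.eval a • Lagrange.basis S id a) ?_ ?_
    · rw [map_sub, sub_eq_zero, map_sum] at h
      rw [h]
      exact Finset.sum_congr rfl fun a _ => by rw [map_smul, smul_eq_mul, mul_comm]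
    · refine (degree_sub_le _ _).trans_lt (max_lt hf ?_)
      refine (degree_sum_le _ _).trans_lt ((Finset.sup_lt_iff (a := (N : WithBot ℕ)) (WithBot.bot_lt_coe N)).2 ?_)
      intro a ha
      have hc : 0 < S.card := Finset.card_pos.2 ⟨a, ha⟩
      refine (degree_smul_le _ _).trans_lt ?_
      rw [hbdeg a ha]; norm_cast; omega
    · intro b hb
      rw [eval_sub, eval_finsetSum, Finset.sum_eq_single b]
      · simp [hself b hb]
      · intro a _ hab; simp [hne a b hb hab]
      · exact fun h => absurd hb h

/-! ### Moment functionals and moment matrices -/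

/-- The linear functional on polynomials with moments `s`. -/
noncomputable def momentFunctional (s : ℕ → ℝ) : ℝ[X] →ₗ[ℝ] ℝ :=
  Polynomial.lsum fun i => s i • LinearMap.id

theorem momentFunctional_apply (s : ℕ → ℝ) (f : ℝ[X]) :
    momentFunctional s f = f.sum fun i c => s i * c := by
  simp [momentFunctional, Polynomial.lsum_apply]

theorem momentFunctional_monomial (s : ℕ → ℝ) (i : ℕ) (c : ℝ) :
    momentFunctional s (monomial i c) = s i * c := by
  rw [momentFunctional_apply, sum_monomial_index _ _ (by simp)]

@[simp] theorem momentFunctional_X_pow (s : ℕ → ℝ) (i : ℕ) :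
    momentFunctional s (X ^ i) = s i := by
  rw [X_pow_eq_monomial, momentFunctional_monomial, mul_one]

theorem linearMap_eq_of_degree_lt {L L' : ℝ[X] →ₗ[ℝ] ℝ} {N : ℕ}
    (h : ∀ i < N, L (X ^ i) = L' (X ^ i)) {f : ℝ[X]} (hf : f.degree < N) : L f = L' f := by
  rw [f.as_sum_support, map_sum, map_sum]
  refine Finset.sum_congr rfl fun i hi => ?_
  rw [← C_mul_X_pow_eq_monomial, ← smul_eq_C_mul, map_smul, map_smul, h i]
  by_contra! hN
  exact (mem_support_iff.1 hi) (coeff_eq_zero_of_degree_lt (hf.trans_le (by exact_mod_cast hN)))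

theorem momentFunctional_tail (m : ℕ) (s : ℕ → ℝ) (f : ℝ[X]) :
    momentFunctional (tail m s) f = momentFunctional s (X ^ m * f) := by
  have : momentFunctional (tail m s) =
      momentFunctional s ∘ₗ LinearMap.mulLeft ℝ (X ^ m : ℝ[X]) := by
    ext i
    simp [momentFunctional_monomial, tail, X_pow_mul_monomial, add_comm]
  rw [this]; rfl

theorem momentFunctional_fillOne (s : ℕ → ℝ) (x : ℝ) (f : ℝ[X]) :
    momentFunctional (fillOne s x) f =
      momentFunctional (fillOne s 0) f + x * f.coeff 1 := by
  have : momentFunctional (fillOne s x) = momentFunctional (fillOne s 0) + x • lcoeff ℝ 1 := by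
    ext i
    by_cases hi : i = 1 <;>
      simp [momentFunctional_monomial, fillOne, hi, coeff_monomial]
  rw [this]; simp

/-- The matrix `(s_{e i + e j})`. -/
def momentMatrix {ι : Type*} (s : ℕ → ℝ) (e : ι → ℕ) : Matrix ι ι ℝ :=
  Matrix.of fun i j => s (e i + e j)

theorem momentMatrix_isHermitian {ι : Type*} (s : ℕ → ℝ) (e : ι → ℕ) :
    (momentMatrix s e).IsHermitian := by
  ext i j; simp [momentMatrix, add_comm]

/-- The polynomial with exponents `e` and coefficients `v`. -/
noncomputable def expPoly {ι : Type*} [Fintype ι] (e : ι → ℕ) (v : ι → ℝ) : ℝ[X] :=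
  ∑ i, monomial (e i) (v i)

section

variable {ι : Type*} [Fintype ι] (s : ℕ → ℝ) (e : ι → ℕ)

theorem coeff_expPoly {e : ι → ℕ} (he : Function.Injective e) (v : ι → ℝ) (i : ι) :
    (expPoly e v).coeff (e i) = v i := by
  classical
  rw [expPoly, finsetSum_coeff, Finset.sum_eq_single i]
  · simp
  · intro j _ hj; simp [coeff_monomial, he.ne hj]
  · simp

theorem expPoly_ne_zero {e : ι → ℕ} (he : Function.Injective e) {v : ι → ℝ} (hv : v ≠ 0) :
    expPoly e v ≠ 0 := by
  intro h
  apply hv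
  ext i
  rw [← coeff_expPoly he v i, h]; simp

theorem expPoly_coeff {e : ι → ℕ} (he : Function.Injective e) {f : ℝ[X]}
    (hf : ∀ n, f.coeff n ≠ 0 → n ∈ Set.range e) : expPoly e (fun i => f.coeff (e i)) = f := by
  classical
  ext n
  by_cases hn : n ∈ Set.range e
  · obtain ⟨i, rfl⟩ := hn
    exact coeff_expPoly he _ i
  · rw [not_not.1 (mt (hf n) hn), expPoly, finsetSum_coeff]
    refine Finset.sum_eq_zero fun i _ => ?_
    rw [coeff_monomial, if_neg]
    rintro rfl
    exact hn ⟨i, rfl⟩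

theorem dotProduct_momentMatrix_mulVec (v w : ι → ℝ) :
    v ⬝ᵥ (momentMatrix s e).mulVec w = momentFunctional s (expPoly e v * expPoly e w) := by
  rw [expPoly, expPoly, Finset.sum_mul_sum, map_sum, dotProduct]
  refine Finset.sum_congr rfl fun i _ => ?_
  rw [map_sum, Matrix.mulVec, dotProduct, Finset.mul_sum]
  refine Finset.sum_congr rfl fun j _ => ?_
  rw [monomial_mul_monomial, momentFunctional_monomial, momentMatrix, Matrix.of_apply]
  ring

theorem momentMatrix_posSemidef_iff : (momentMatrix s e).PosSemidef ↔
    ∀ v, 0 ≤ momentFunctional s (expPoly e v * expPoly e v) := by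
  rw [Matrix.posSemidef_iff_dotProduct_mulVec]
  simp only [momentMatrix_isHermitian, star_trivial, dotProduct_momentMatrix_mulVec, true_and]

theorem momentMatrix_posDef_iff : (momentMatrix s e).PosDef ↔
    ∀ v, v ≠ 0 → 0 < momentFunctional s (expPoly e v * expPoly e v) := by
  rw [Matrix.posDef_iff_dotProduct_mulVec]
  simp only [momentMatrix_isHermitian, star_trivial, dotProduct_momentMatrix_mulVec, true_and,
    ne_eq]

theorem momentMatrix_mulVec_eq_zero_iff (v : ι → ℝ) : (momentMatrix s e).mulVec v = 0 ↔
    ∀ w, momentFunctional s (expPoly e v * expPoly e w) = 0 := by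
  simp_rw [mul_comm (expPoly e v), ← dotProduct_momentMatrix_mulVec]
  constructor
  · intro h w; simp [h]
  · intro h; exact dotProduct_eq_zero _ fun w => by rw [dotProduct_comm]; exact h w

end

/-! ### Kernels and ranks of principal submatrices -/

theorem _root_.Matrix.mulVec_extend_zero {l m n : Type*} [Fintype m] [Fintype n]
    (H : Matrix l m ℝ) {e : n → m} (he : Function.Injective e) (w : n → ℝ) (j : l) :
    H.mulVec (Function.extend e w 0) j = ∑ k, H j (e k) * w k := by
  rw [Matrix.mulVec, dotProduct]
  refine (Fintype.sum_of_injective e he _ _ (fun k hk => ?_) fun k => ?_).symm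
  · rw [Function.extend_apply' _ _ _ (by simpa using hk)]; simp
  · rw [he.extend_apply]

/-- Padding by zeros leaves the value of the quadratic form unchanged, and for a semidefinite matrix
the kernel consists of the vectors on which that form vanishes. -/
theorem _root_.Matrix.PosSemidef.submatrix_mulVec_eq_zero_iff {m n : Type*} [Fintype m]
    [Fintype n] {H : Matrix m m ℝ} (hH : H.PosSemidef) {e : n → m}
    (he : Function.Injective e) (w : n → ℝ) :
    (H.submatrix e e).mulVec w = 0 ↔ H.mulVec (Function.extend e w 0) = 0 := by
  constructor
  · intro h
    rw [← hH.dotProduct_mulVec_zero_iff]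
    have h2 : w ⬝ᵥ (H.submatrix e e).mulVec w = 0 := by rw [h, dotProduct_zero]
    rw [← h2, dotProduct, dotProduct]
    refine (Fintype.sum_of_injective e he _ _ (fun k hk => ?_) fun k => ?_).symm
    · rw [Pi.star_apply, Function.extend_apply' _ _ _ (by simpa using hk)]; simp
    · rw [Pi.star_apply, he.extend_apply, Matrix.mulVec_extend_zero H he]; rfl
  · intro h
    ext j
    have := congrFun h (e j)
    rw [Matrix.mulVec_extend_zero H he] at this
    exact this

theorem _root_.Matrix.rank_add_finrank_ker {m : Type*} [Fintype m] (H : Matrix m m ℝ) :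
    H.rank + Module.finrank ℝ (LinearMap.ker H.mulVecLin) = Fintype.card m := by
  rw [Matrix.rank, LinearMap.finrank_range_add_finrank_ker, Module.finrank_fintype_fun_eq_card]

/-- Removing one index from a positive semidefinite matrix preserves the rank exactly when the
kernel contains a vector whose coordinate at that index does not vanish. -/
theorem _root_.Matrix.PosSemidef.rank_submatrix_eq_iff {m n : Type*} [Fintype m] [Fintype n]
    {H : Matrix m m ℝ} (hH : H.PosSemidef) {e : n → m} (he : Function.Injective e) {i : m}
    (hi : Set.range e = {i}ᶜ) :
    (H.submatrix e e).rank = H.rank ↔ ∃ v, H.mulVec v = 0 ∧ v i ≠ 0 := by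
  classical
  set E := Function.ExtendByZero.linearMap ℝ e with hE
  set K := LinearMap.ker H.mulVecLin
  set K' := LinearMap.ker (H.submatrix e e).mulVecLin
  set P := LinearMap.ker (LinearMap.proj i : (m → ℝ) →ₗ[ℝ] ℝ)
  have hEinj : Function.Injective E := by
    intro v w h
    ext k
    have := congrFun h (e k)
    simpa [hE, he.extend_apply] using this
  have hrange : LinearMap.range E = P := by
    ext v
    constructor
    · rintro ⟨w, rfl⟩
      have : i ∉ Set.range e := by rw [hi]; simp
      change Function.extend e w 0 i = 0
      rw [Function.extend_apply' _ _ _ (by simpa using this)]; rfl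
    · intro hv
      refine ⟨v ∘ e, ?_⟩
      ext j
      change Function.extend e (v ∘ e) 0 j = v j
      by_cases hj : j ∈ Set.range e
      · obtain ⟨k, rfl⟩ := hj
        rw [he.extend_apply]; rfl
      · rw [Function.extend_apply' _ _ _ (by simpa using hj)]
        rw [hi] at hj
        have : j = i := by simpa using hj
        subst this
        exact (LinearMap.mem_ker.1 hv).symm
  have hK' : K' = K.comap E := by
    ext w
    exact hH.submatrix_mulVec_eq_zero_iff he w
  -- The kernel of the submatrix is `K ⊓ P` up to isomorphism, and `P` is a hyperplane. Equal ranks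
  -- therefore mean that intersecting `K` with `P` lowers its dimension by one, that is, `K` is not
  -- contained in `P`.
  have hK0 : Module.finrank ℝ K' = Module.finrank ℝ (K ⊓ P : Submodule ℝ (m → ℝ)) := by
    rw [hK', inf_comm, ← hrange, ← Submodule.map_comap_eq]
    exact (Submodule.equivMapOfInjective E hEinj _).finrank_eq
  have hP : Module.finrank ℝ P = Fintype.card n := by
    rw [← hrange, LinearMap.finrank_range_of_inj hEinj, Module.finrank_fintype_fun_eq_card]
  have hP1 : Module.finrank ℝ P + 1 = Fintype.card m := by
    have h := LinearMap.finrank_range_add_finrank_ker (LinearMap.proj i : (m → ℝ) →ₗ[ℝ] ℝ)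
    rw [LinearMap.range_eq_top.2 (LinearMap.proj_surjective i), finrank_top,
      Module.finrank_self, Module.finrank_fintype_fun_eq_card] at h
    rw [← h, add_comm]
  have h1 := H.rank_add_finrank_ker
  have h2 := (H.submatrix e e).rank_add_finrank_ker
  have h3 := Submodule.finrank_sup_add_finrank_inf_eq K P
  have h4 : Module.finrank ℝ (K ⊔ P : Submodule ℝ (m → ℝ)) ≤ Fintype.card m := by
    rw [← Module.finrank_fintype_fun_eq_card ℝ]; exact Submodule.finrank_le _
  have h5 : Module.finrank ℝ (K ⊓ P : Submodule ℝ (m → ℝ)) ≤ Module.finrank ℝ K :=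
    Submodule.finrank_mono inf_le_left
  have h6 : (∃ v, H.mulVec v = 0 ∧ v i ≠ 0) ↔ ¬ K ≤ P := by
    rw [SetLike.not_le_iff_exists]; rfl
  have h7 : K ≤ P ↔ Module.finrank ℝ (K ⊓ P : Submodule ℝ (m → ℝ)) = Module.finrank ℝ K := by
    constructor
    · intro h; rw [inf_eq_left.2 h]
    · intro h; exact inf_eq_left.1 (Submodule.eq_of_le_of_finrank_eq inf_le_left h)
  change _ + Module.finrank ℝ K = _ at h1
  change _ + Module.finrank ℝ K' = _ at h2
  rw [h6, h7]
  omega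

/-! ### Positive functionals with an unspecified first moment -/

/-- Degenerate Cauchy–Schwarz: the quadratic in `t` has no square term, and an affine function
bounded below has slope zero. The `t` used in the proof would make its value `-1`. -/
theorem map_mul_eq_zero_of_nonneg (L : ℝ[X] →ₗ[ℝ] ℝ) {f g : ℝ[X]}
    (h : ∀ t : ℝ, 0 ≤ L ((g + t • f) * (g + t • f))) (hf : L (f * f) = 0) : L (f * g) = 0 := by
  have h1 : ∀ t : ℝ, 0 ≤ L (g * g) + 2 * t * L (f * g) := by
    intro t
    have h2 := h t
    have h3 : (g + t • f) * (g + t • f) = g * g + (2 * t) • (f * g) + (t ^ 2) • (f * f) := by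
      simp only [smul_eq_C_mul, C_mul, C_pow, C_ofNat]; ring
    rwa [h3, map_add, map_add, map_smul, map_smul, hf, smul_zero, add_zero, smul_eq_mul] at h2
  by_contra hne
  have h2 := h1 (-(L (g * g) + 1) / (2 * L (f * g)))
  have h3 : 2 * (-(L (g * g) + 1) / (2 * L (f * g))) * L (f * g) = -(L (g * g) + 1) := by
    field_simp
  linarith

/-- A positive definite form on the finite-dimensional space `degreeLT ℝ n` embeds it in its dual,
hence identifies the two; `f` represents the functional `g ↦ L (u * (X ^ m * g))`. -/
theorem exists_orthogonal_projection (L : ℝ[X] →ₗ[ℝ] ℝ) (m n : ℕ)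
    (hpos : ∀ f : ℝ[X], f ≠ 0 → f.degree < n → 0 < L (X ^ m * f * (X ^ m * f))) (u : ℝ[X]) :
    ∃ f : ℝ[X], f.degree < n ∧
      ∀ g : ℝ[X], g.degree < n → L ((u - X ^ m * f) * (X ^ m * g)) = 0 := by
  set V := degreeLT ℝ n
  set B : ℝ[X] →ₗ[ℝ] ℝ[X] →ₗ[ℝ] ℝ := (LinearMap.mul ℝ ℝ[X]).compr₂ L
  set B' := B.compl₁₂ (LinearMap.mulLeft ℝ (X ^ m : ℝ[X])) (LinearMap.mulLeft ℝ (X ^ m : ℝ[X]))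
  set φ : V →ₗ[ℝ] Module.Dual ℝ V := B'.domRestrict₁₂ V V
  have : FiniteDimensional ℝ V := (degreeLTEquiv ℝ n).symm.finiteDimensional
  have hinj : Function.Injective φ := by
    rw [← LinearMap.ker_eq_bot, LinearMap.ker_eq_bot']
    intro f hf
    by_contra hne
    have h1 := hpos f (by simpa using hne) (mem_degreeLT.1 f.2)
    have h2 : φ f f = 0 := by rw [hf]; rfl
    exact h1.ne' h2
  have hsurj : Function.Surjective φ :=
    (LinearMap.injective_iff_surjective_of_finrank_eq_finrank
      (Subspace.dual_finrank_eq).symm).1 hinj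
  obtain ⟨f, hf⟩ := hsurj
    ((B u ∘ₗ LinearMap.mulLeft ℝ (X ^ m : ℝ[X])).domRestrict V)
  refine ⟨(f : ℝ[X]), mem_degreeLT.1 f.2, fun g hg => ?_⟩
  have h1 := LinearMap.congr_fun hf ⟨g, mem_degreeLT.2 hg⟩
  have h2 : L (X ^ m * (f : ℝ[X]) * (X ^ m * g)) = L (u * (X ^ m * g)) := h1
  rw [sub_mul, map_sub, h2, sub_self]

/-- Adding `x` to the first moment of a functional. -/
noncomputable def shiftFirst (L : ℝ[X] →ₗ[ℝ] ℝ) (x : ℝ) : ℝ[X] →ₗ[ℝ] ℝ := L + x • lcoeff ℝ 1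

@[simp] theorem shiftFirst_apply (L : ℝ[X] →ₗ[ℝ] ℝ) (x : ℝ) (f : ℝ[X]) :
    shiftFirst L x f = L f + x * f.coeff 1 := rfl

/-- This governs the effect of `x` on the form: none if both factors lack a constant term, or both
lack a linear term. -/
theorem coeff_one_mul (f g : ℝ[X]) :
    (f * g).coeff 1 = f.coeff 0 * g.coeff 1 + f.coeff 1 * g.coeff 0 := by
  rw [coeff_mul]; simp [Finset.Nat.antidiagonal_succ]

theorem exists_eq_add_X_sq_mul (f : ℝ[X]) {n : ℕ} (hf : f.degree < (n + 2 : ℕ)) :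
    ∃ q : ℝ[X], q.degree < n ∧ f = C (f.coeff 0) + C (f.coeff 1) * X + X ^ 2 * q := by
  refine ⟨f.divX.divX, ?_, ?_⟩
  · rw [degree_lt_iff_coeff_zero] at hf ⊢
    intro i hi
    rw [coeff_divX, coeff_divX]
    exact hf _ (by omega)
  · conv_lhs => rw [← divX_mul_X_add f, ← divX_mul_X_add f.divX]
    rw [coeff_divX]; ring

theorem eq_of_coeff_zero {f : ℝ[X]} {n : ℕ} (hf : f.degree < (n + 1 : ℕ)) (h : f.coeff n = 0) :
    f.degree < n := by
  rw [degree_lt_iff_coeff_zero] at hf ⊢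
  intro i hi
  rcases hi.eq_or_lt with rfl | h'
  · exact h
  · exact hf _ h'

/-- In the positive definite case some choice of the first moment gives a quadrature rule with
the minimal number of nodes. -/
theorem exists_quadrature_of_posDef (L : ℝ[X] →ₗ[ℝ] ℝ) {n : ℕ}
    (hT : ∀ f : ℝ[X], f ≠ 0 → f.degree < (n + 2 : ℕ) → 0 < L (X * f * (X * f)))
    (hG : ∀ g : ℝ[X], g.degree < (n + 3 : ℕ) → g.coeff 1 = 0 → 0 ≤ L (g * g))
    (hG' : ∀ g : ℝ[X], g ≠ 0 → g.degree < (n + 2 : ℕ) → g.coeff 1 = 0 → 0 < L (g * g)) :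
    ∃ (x : ℝ) (S : Finset ℝ) (w : ℝ → ℝ), S.card = n + 2 ∧ (∀ a ∈ S, 0 < w a) ∧
      ∀ f : ℝ[X], f.degree < (2 * (n + 2) + 1 : ℕ) →
        shiftFirst L x f = ∑ a ∈ S, w a * f.eval a := by
  have hB : ∀ f : ℝ[X], f ≠ 0 → f.degree < (n + 1 : ℕ) → 0 < L (X ^ 2 * f * (X ^ 2 * f)) := by
    intro f hf hd
    have := hT (X * f) (mul_ne_zero X_ne_zero hf) (by
      rw [degree_mul, degree_X, degree_eq_natDegree hf] at *
      norm_cast at *; omega)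
    convert this using 2; ring
  obtain ⟨h0, h0d, h0o⟩ := exists_orthogonal_projection L 2 (n + 1) hB 1
  obtain ⟨h1, h1d, h1o⟩ := exists_orthogonal_projection L 2 (n + 1) hB X
  -- `g` and `e` are the components of `1` and `X` orthogonal to the multiples of `X ^ 2`. On their
  -- span the form has diagonal entries `σ ^ 2`, `τ ^ 2` and off-diagonal entry `L (g * e) + x`.
  set g : ℝ[X] := 1 - X ^ 2 * h0 with hg
  set e : ℝ[X] := X - X ^ 2 * h1 with he
  have hX2 : ∀ q : ℝ[X], (X ^ 2 * q).coeff 0 = 0 ∧ (X ^ 2 * q).coeff 1 = 0 := by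
    intro q
    rw [pow_two, mul_assoc]
    exact ⟨by simp, by rw [show 1 = 0 + 1 from rfl, coeff_X_mul]; simp⟩
  have hg0 : g.coeff 0 = 1 := by rw [hg, coeff_sub, (hX2 h0).1]; simp
  have hg1 : g.coeff 1 = 0 := by rw [hg, coeff_sub, (hX2 h0).2]; simp [coeff_one]
  have he0 : e.coeff 0 = 0 := by rw [he, coeff_sub, (hX2 h1).1]; simp
  have he1 : e.coeff 1 = 1 := by rw [he, coeff_sub, (hX2 h1).2]; simp
  have hX2d : ∀ q : ℝ[X], q.degree < (n + 1 : ℕ) → (X ^ 2 * q : ℝ[X]).degree < (n + 3 : ℕ) := by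
    intro q hq
    rw [degree_lt_iff_coeff_zero] at hq ⊢
    intro i hi
    obtain ⟨j, rfl⟩ : ∃ j, i = j + 2 := ⟨i - 2, by omega⟩
    rw [coeff_X_pow_mul]; exact hq _ (by omega)
  have hgd : g.degree < (n + 3 : ℕ) := by
    refine (degree_sub_le _ _).trans_lt (max_lt ?_ (hX2d _ h0d))
    rw [degree_one]; norm_cast; omega
  have hed : e.degree < (n + 3 : ℕ) := by
    refine (degree_sub_le _ _).trans_lt (max_lt ?_ (hX2d _ h1d))
    rw [degree_X]; norm_cast; omega
  have hgne : g ≠ 0 := fun h => by simp [h] at hg0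
  have hD1 : 0 ≤ L (g * g) := hG g hgd hg1
  have hD2 : 0 < L (e * e) := by
    have hee : e = X * (1 - X * h1) := by rw [he]; ring
    have hne : (1 - X * h1) ≠ 0 := fun h => by rw [hee, h] at he1; simp at he1
    rw [hee]
    apply hT _ hne
    rw [hee, degree_mul, degree_X, degree_eq_natDegree hne] at hed
    rw [degree_eq_natDegree hne]
    norm_cast at *; omega
  set σ := √(L (g * g)) with hσ
  set τ := √(L (e * e)) with hτ
  have hσ2 : σ ^ 2 = L (g * g) := Real.sq_sqrt hD1
  have hτ2 : τ ^ 2 = L (e * e) := Real.sq_sqrt hD2.le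
  have hτ0 : 0 < τ := Real.sqrt_pos.2 hD2
  -- the endpoints of the interval of admissible first moments
  set x : ℝ → ℝ := fun ε => ε * σ * τ - L (g * e) with hx
  -- For `ε = ±1` the off-diagonal entry at `x ε` is `ε * σ * τ`, the Gram determinant vanishes, and
  -- `p ε` is a kernel vector.
  set p : ℝ → ℝ[X] := fun ε => τ • g - (ε * σ) • e with hp
  have hdecomp : ∀ f : ℝ[X], f.degree < (n + 3 : ℕ) → ∃ q : ℝ[X], q.degree < (n + 1 : ℕ) ∧
      f = f.coeff 0 • g + f.coeff 1 • e + X ^ 2 * q := by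
    intro f hf
    obtain ⟨q, hq, hfq⟩ := exists_eq_add_X_sq_mul f hf
    refine ⟨q + f.coeff 0 • h0 + f.coeff 1 • h1, ?_, ?_⟩
    · refine (degree_add_le _ _).trans_lt (max_lt ((degree_add_le _ _).trans_lt (max_lt hq ?_)) ?_)
      · exact (degree_smul_le _ _).trans_lt h0d
      · exact (degree_smul_le _ _).trans_lt h1d
    · conv_lhs => rw [hfq]
      simp only [hg, he, smul_eq_C_mul]; ring
  have hLgg : ∀ y, shiftFirst L y (g * g) = σ ^ 2 := by
    intro y; simp [coeff_one_mul, hg1, hσ2]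
  have hLee : ∀ y, shiftFirst L y (e * e) = τ ^ 2 := by
    intro y; simp [coeff_one_mul, he0, hτ2]
  have hLge : ∀ ε, shiftFirst L (x ε) (g * e) = ε * σ * τ := by
    intro ε; simp [coeff_one_mul, hg0, hg1, he0, he1, hx]
  have hLgq : ∀ (y : ℝ) (q : ℝ[X]), q.degree < (n + 1 : ℕ) → shiftFirst L y (g * (X ^ 2 * q)) = 0 := by
    intro y q hq
    rw [shiftFirst_apply, coeff_one_mul, (hX2 q).1, (hX2 q).2, h0o q hq]; ring
  have hLeq : ∀ (y : ℝ) (q : ℝ[X]), q.degree < (n + 1 : ℕ) → shiftFirst L y (e * (X ^ 2 * q)) = 0 := by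
    intro y q hq
    rw [shiftFirst_apply, coeff_one_mul, (hX2 q).1, (hX2 q).2, h1o q hq]; ring
  have horth : ∀ ε, ε ^ 2 = 1 → ∀ f : ℝ[X], f.degree < (n + 3 : ℕ) →
      shiftFirst L (x ε) (p ε * f) = 0 := by
    intro ε hε f hf
    obtain ⟨q, hq, hfq⟩ := hdecomp f hf
    have : p ε * f = (τ * f.coeff 0) • (g * g) + (τ * f.coeff 1 - ε * σ * f.coeff 0) • (g * e)
        - (ε * σ * f.coeff 1) • (e * e) + τ • (g * (X ^ 2 * q)) - (ε * σ) • (e * (X ^ 2 * q)) := by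
      conv_lhs => rw [hfq]
      simp only [hp, smul_eq_C_mul, C_mul, C_sub]; ring
    rw [this]
    simp only [map_add, map_sub, map_smul, hLgg, hLee, hLge, hLgq _ q hq, hLeq _ q hq, smul_eq_mul]
    linear_combination (-τ * σ ^ 2 * f.coeff 0) * hε
  have hker : ∀ ε, ε ^ 2 = 1 → ∀ f : ℝ[X], f.degree < (n + 3 : ℕ) →
      shiftFirst L (x ε) (f * f) ≤ 0 → ∃ c : ℝ, f = c • p ε := by
    intro ε hε f hf hle
    obtain ⟨q, hq, hfq⟩ := hdecomp f hf
    set a := f.coeff 0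
    set b := f.coeff 1
    have h2 : f * f = a ^ 2 • (g * g) + (2 * a * b) • (g * e) + b ^ 2 • (e * e)
        + (2 * a) • (g * (X ^ 2 * q)) + (2 * b) • (e * (X ^ 2 * q)) + X ^ 2 * q * (X ^ 2 * q) := by
      conv_lhs => rw [hfq]
      simp only [smul_eq_C_mul, C_mul, C_pow, C_ofNat]; ring
    rw [h2] at hle
    simp only [map_add, map_smul, hLgg, hLee, hLge, hLgq _ q hq, hLeq _ q hq, smul_eq_mul] at hle
    rw [shiftFirst_apply, coeff_one_mul, (hX2 q).1, (hX2 q).2] at hle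
    -- At an endpoint the 2×2 form is a perfect square, so a nonpositive total forces `q = 0` and
    -- `(a, b)` proportional to `(τ, -ε * σ)`.
    have hsq : a ^ 2 * σ ^ 2 + 2 * a * b * (ε * σ * τ) + b ^ 2 * τ ^ 2 = (a * σ + ε * b * τ) ^ 2 := by
      linear_combination (-b ^ 2 * τ ^ 2) * hε
    have hq0 : q = 0 := by
      by_contra hne
      nlinarith [hB q hne hq, sq_nonneg (a * σ + ε * b * τ)]
    have hab : a * σ + ε * b * τ = 0 := by
      have : (a * σ + ε * b * τ) ^ 2 ≤ 0 := by
        simp only [hq0, mul_zero, map_zero] at hle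
        linarith
      exact pow_eq_zero_iff (two_ne_zero) |>.1 (le_antisymm this (sq_nonneg _))
    refine ⟨a / τ, ?_⟩
    have hb : b = -(a / τ * (ε * σ)) := by
      field_simp
      linear_combination ε * hab - b * τ * hε
    rw [hfq, hq0, hb]
    simp only [hp, smul_sub, smul_smul]
    rw [div_mul_cancel₀ _ hτ0.ne']
    simp [sub_eq_add_neg]
  have main : ∀ ε, ε ^ 2 = 1 → (p ε).coeff (n + 2) ≠ 0 →
      ∃ (x : ℝ) (S : Finset ℝ) (w : ℝ → ℝ), S.card = n + 2 ∧ (∀ a ∈ S, 0 < w a) ∧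
      ∀ f : ℝ[X], f.degree < (2 * (n + 2) + 1 : ℕ) →
        shiftFirst L x f = ∑ a ∈ S, w a * f.eval a := by
    intro ε hε hc
    have hpd : (p ε).degree < (n + 3 : ℕ) := by
      refine (degree_sub_le _ _).trans_lt (max_lt ?_ ?_)
      · exact (degree_smul_le _ _).trans_lt hgd
      · exact (degree_smul_le _ _).trans_lt hed
    have hp0 : p ε ≠ 0 := fun h => by simp [h] at hc
    have hpn : (p ε).natDegree = n + 2 := by
      refine le_antisymm ?_ (le_natDegree_of_ne_zero hc)
      rw [degree_eq_natDegree hp0] at hpd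
      norm_cast at hpd; omega
    have hO : ∀ q : ℝ[X], (p ε * q).degree < (2 * (n + 2) + 1 : ℕ) →
        shiftFirst L (x ε) (p ε * q) = 0 := by
      intro q hq
      by_cases hq0 : q = 0
      · simp [hq0]
      apply horth ε hε
      rw [degree_mul, degree_eq_natDegree hp0, degree_eq_natDegree hq0, hpn] at hq
      rw [degree_eq_natDegree hq0]
      norm_cast at *; omega
    have hP : ∀ f : ℝ[X], f ≠ 0 → f.degree < (p ε).natDegree →
        0 < shiftFirst L (x ε) (f * f) := by
      intro f hf hfd
      by_contra! hle
      rw [hpn] at hfd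
      obtain ⟨c, hcf⟩ := hker ε hε f (hfd.trans (by norm_cast; omega)) hle
      have h3 : f.coeff (n + 2) = 0 := coeff_eq_zero_of_degree_lt hfd
      rw [hcf, coeff_smul, smul_eq_mul, mul_eq_zero] at h3
      rcases h3 with h3 | h3
      · apply hf; rw [hcf, h3, zero_smul]
      · exact hc h3
    obtain ⟨S, w, hS, hw, -, hL⟩ := exists_quadrature (shiftFirst L (x ε)) hp0 (by omega) hO hP
    exact ⟨x ε, S, w, hS.trans hpn, hw, hL⟩
  -- If both endpoint polynomials drop degree, then so does `g`; strict positivity below top degree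
  -- gives `σ > 0`, and `e` drops too. Now `X * g` and `X * e` are admissible test polynomials:
  -- testing with `X * e` gives `L (g * (X * e)) = 0`, then testing with `X * g` makes the endpoints
  -- coincide, although they differ by `2 * σ * τ`.
  by_contra hcon
  have hc1 := not_imp_not.2 (main 1 (by norm_num)) hcon
  have hc2 := not_imp_not.2 (main (-1) (by norm_num)) hcon
  rw [not_not] at hc1 hc2
  simp only [hp, coeff_sub, coeff_smul, smul_eq_mul] at hc1 hc2
  have hgn : g.coeff (n + 2) = 0 := by
    have : τ * g.coeff (n + 2) = 0 := by linarith
    exact (mul_eq_zero.1 this).resolve_left hτ0.ne'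
  have hgd' := eq_of_coeff_zero hgd hgn
  have hσ0 : 0 < σ := Real.sqrt_pos.2 (hG' g hgne hgd' hg1)
  have hen : e.coeff (n + 2) = 0 := by
    have : σ * e.coeff (n + 2) = 0 := by linarith
    exact (mul_eq_zero.1 this).resolve_left hσ0.ne'
  have hed' := eq_of_coeff_zero hed hen
  have hXd : ∀ f : ℝ[X], f.degree < (n + 2 : ℕ) → (X * f : ℝ[X]).degree < (n + 3 : ℕ) := by
    intro f hf
    rw [degree_lt_iff_coeff_zero] at hf ⊢
    intro i hi
    obtain ⟨j, rfl⟩ : ∃ j, i = j + 1 := ⟨i - 1, by omega⟩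
    rw [coeff_X_mul]; exact hf _ (by omega)
  have hexp : ∀ ε (f : ℝ[X]), shiftFirst L (x ε) (p ε * (X * f)) =
      τ * L (g * (X * f)) - ε * σ * L (e * (X * f)) + x ε * (τ * f.coeff 0) := by
    intro ε f
    rw [shiftFirst_apply, coeff_one_mul, show (1 : ℕ) = 0 + 1 from rfl, coeff_X_mul]
    simp [hp, sub_mul, hg0, he0]
  have e1 := horth 1 (by norm_num) _ (hXd g hgd')
  have e2 := horth (-1) (by norm_num) _ (hXd g hgd')
  have e3 := horth 1 (by norm_num) _ (hXd e hed')
  have e4 := horth (-1) (by norm_num) _ (hXd e hed')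
  rw [hexp] at e1 e2 e3 e4
  rw [hg0] at e1 e2
  rw [he0] at e3 e4
  have e5 : L (g * (X * e)) = 0 := by
    have : τ * L (g * (X * e)) = 0 := by linarith
    exact (mul_eq_zero.1 this).resolve_left hτ0.ne'
  rw [show e * (X * g) = g * (X * e) by ring, e5] at e1 e2
  have e6 : (x 1 - x (-1)) * τ = 0 := by linarith
  have e7 : x 1 - x (-1) = 2 * σ * τ := by simp only [hx]; ring
  rw [e7] at e6
  exact (by positivity : 2 * σ * τ * τ ≠ 0) e6

/-! ### Isotropic polynomials and the singular case -/

theorem degree_X_mul_lt {f : ℝ[X]} {n : ℕ} (hf : f.degree < n) :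
    (X * f : ℝ[X]).degree < (n + 1 : ℕ) := by
  rw [degree_lt_iff_coeff_zero] at hf ⊢
  intro i hi
  obtain ⟨j, rfl⟩ : ∃ j, i = j + 1 := ⟨i - 1, by omega⟩
  rw [coeff_X_mul]; exact hf _ (by omega)

theorem degree_mul_self_lt {f : ℝ[X]} {n : ℕ} (hf : f.degree < (n + 1 : ℕ)) :
    (f * f).degree < (2 * n + 1 : ℕ) := by
  by_cases hf0 : f = 0
  · rw [hf0, mul_zero, degree_zero]; exact WithBot.bot_lt_coe _
  · rw [degree_mul]
    rw [degree_eq_natDegree hf0] at *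
    norm_cast at *; omega

theorem X_mul_orthogonal (L : ℝ[X] →ₗ[ℝ] ℝ) {k : ℕ}
    (hT : ∀ f : ℝ[X], f.degree < k → 0 ≤ L (X * f * (X * f))) {f g : ℝ[X]} (hf : f.degree < k)
    (hg : g.degree < k) (h : L (X * f * (X * f)) = 0) : L (X * f * (X * g)) = 0 := by
  apply map_mul_eq_zero_of_nonneg L _ h
  intro t
  have := hT (g + t • f) ((degree_add_le _ _).trans_lt (max_lt hg
    ((degree_smul_le _ _).trans_lt hf)))
  convert this using 2
  simp only [smul_eq_C_mul]; ring

/-- In the presence of an isotropic polynomial of top degree, the isotropic polynomials are stable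
under multiplication by `X`. -/
theorem isotropic_X_mul (L : ℝ[X] →ₗ[ℝ] ℝ) {n : ℕ}
    (hT : ∀ f : ℝ[X], f.degree < (n + 1 : ℕ) → 0 ≤ L (X * f * (X * f)))
    {e : ℝ[X]} (hed : e.degree < (n + 1 : ℕ)) (hen : e.coeff n ≠ 0)
    (he : L (X * e * (X * e)) = 0) {f : ℝ[X]} (hf : f.degree < n)
    (h : L (X * f * (X * f)) = 0) : L (X * (X * f) * (X * (X * f))) = 0 := by
  have hXf := degree_X_mul_lt hf
  have hf' : f.degree < (n + 1 : ℕ) := hf.trans (by norm_cast; omega)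
  -- Cancelling the leading term of `X * f` by `e` leaves room below the degree bound to move one
  -- factor `X` across the form.
  set c := (X * f).coeff n / e.coeff n
  have hu : (X * f - c • e : ℝ[X]).degree < n := by
    apply eq_of_coeff_zero
    · exact (degree_sub_le _ _).trans_lt (max_lt hXf ((degree_smul_le _ _).trans_lt hed))
    · rw [coeff_sub, coeff_smul, smul_eq_mul, div_mul_cancel₀ _ hen, sub_self]
  have h1 : L (X * f * (X * (X * (X * f - c • e)))) = 0 :=
    X_mul_orthogonal L hT hf' (degree_X_mul_lt hu) h
  have h2 : L (X * e * (X * (X * f))) = 0 := X_mul_orthogonal L hT hed hXf he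
  have h3 : X * (X * f) * (X * (X * f)) =
      X * f * (X * (X * (X * f - c • e))) + c • (X * e * (X * (X * f))) := by
    simp only [smul_eq_C_mul]; ring
  rw [h3, map_add, map_smul, h1, h2, smul_zero, add_zero]

/-- One extra linear factor kills the linear coefficient while keeping the constant one. The
resulting multiple of `p` vanishes wherever `p` does, and its square does not see the first moment.
-/
theorem exists_dvd_coeff_one_eq_zero {p : ℝ[X]} {n : ℕ} (hp : p.degree < (n + 1 : ℕ))
    (hp0 : p.coeff 0 ≠ 0) :
    ∃ g : ℝ[X], p ∣ g ∧ g.degree < (n + 2 : ℕ) ∧ g.coeff 1 = 0 ∧ g.coeff 0 ≠ 0 := by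
  refine ⟨p * (1 - C (p.coeff 1 / p.coeff 0) * X), dvd_mul_right _ _, ?_, ?_, ?_⟩
  · have h1 : (1 - C (p.coeff 1 / p.coeff 0) * X : ℝ[X]).degree ≤ 1 := by
      compute_degree
    have hpne : p ≠ 0 := fun h => by simp [h] at hp0
    rw [degree_eq_natDegree hpne] at hp
    rw [degree_mul, degree_eq_natDegree hpne]
    calc _ ≤ (p.natDegree : WithBot ℕ) + 1 := by gcongr
      _ < _ := by norm_cast at *; omega
  · rw [coeff_one_mul]; simp [coeff_one]; field_simp; ring
  · rw [mul_coeff_zero]; simpa using hp0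

/-- In the singular case the functional extends to a quadrature rule with nonzero nodes, completed
by a possible mass at the origin. -/
theorem exists_quadrature_of_isotropic (L : ℝ[X] →ₗ[ℝ] ℝ) {n : ℕ}
    (hT : ∀ f : ℝ[X], f.degree < (n + 1 : ℕ) → 0 ≤ L (X * f * (X * f)))
    (hG : ∀ g : ℝ[X], g.degree < (n + 2 : ℕ) → g.coeff 1 = 0 → 0 ≤ L (g * g))
    {e : ℝ[X]} (hed : e.degree < (n + 1 : ℕ)) (hen : e.coeff n ≠ 0)
    (he : L (X * e * (X * e)) = 0)
    {c : ℝ[X]} (hcd : c.degree < (n + 1 : ℕ)) (hc0 : c.coeff 0 ≠ 0)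
    (hc : L (X * c * (X * c)) = 0) :
    ∃ p : ℝ[X], p ≠ 0 ∧ p.degree < (n + 1 : ℕ) ∧ L (X * p * (X * p)) = 0 ∧
      (∀ f : ℝ[X], f ≠ 0 → f.degree < p.natDegree → 0 < L (X * f * (X * f))) ∧
    ∃ (x m : ℝ) (S : Finset ℝ) (w : ℝ → ℝ), S.card = p.natDegree ∧ (∀ a ∈ S, 0 < w a) ∧
      0 ∉ S ∧ 0 ≤ m ∧
      (∀ f : ℝ[X], f.degree < (2 * (n + 1) + 1 : ℕ) →
        shiftFirst L x f = ∑ a ∈ S, w a * f.eval a + m * f.eval 0) ∧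
      ((∃ g : ℝ[X], g.degree < (n + 2 : ℕ) ∧ g.coeff 1 = 0 ∧ g.coeff 0 ≠ 0 ∧ L (g * g) = 0) →
        m = 0) := by
  classical
  have hex : ∃ d, ∃ f : ℝ[X], f ≠ 0 ∧ f.natDegree = d ∧ f.degree < (n + 1 : ℕ) ∧
      L (X * f * (X * f)) = 0 :=
    ⟨_, c, fun h => by simp [h] at hc0, rfl, hcd, hc⟩
  obtain ⟨p, hp0, hpd, hpk, hp⟩ := Nat.find_spec hex
  have hpr : p.natDegree < n + 1 := by
    rw [degree_eq_natDegree hp0] at hpk; exact_mod_cast hpk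
  have hmin : ∀ f : ℝ[X], f ≠ 0 → f.degree < p.natDegree → 0 < L (X * f * (X * f)) := by
    intro f hf hfd
    have hfn : f.natDegree < p.natDegree := by
      rw [degree_eq_natDegree hf] at hfd; exact_mod_cast hfd
    have hfk : f.degree < (n + 1 : ℕ) := hfd.trans (by exact_mod_cast hpr)
    refine lt_of_le_of_ne (hT f hfk) fun h => ?_
    exact Nat.find_min hex (hpd ▸ hfn) ⟨f, hf, rfl, hfk, h.symm⟩
  have hiso : ∀ j, p.natDegree + j < n + 1 → L (X * (X ^ j * p) * (X * (X ^ j * p))) = 0 := by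
    intro j
    induction j with
    | zero => intro _; simpa using hp
    | succ j ih =>
      intro hj
      have := isotropic_X_mul L hT hed hen he (f := X ^ j * p) ?_ (ih (by omega))
      · convert this using 2; ring
      · rw [degree_mul, degree_X_pow, degree_eq_natDegree hp0]; norm_cast; omega
  have horth : ∀ q : ℝ[X], (p * q).degree < (2 * n + 1 : ℕ) → L (X ^ 2 * (p * q)) = 0 := by
    intro q hq
    by_cases hq0 : q = 0
    · simp [hq0]
    have hqd : q.degree < (2 * n + 1 - p.natDegree : ℕ) := by
      rw [degree_mul, degree_eq_natDegree hp0, degree_eq_natDegree hq0] at hq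
      rw [degree_eq_natDegree hq0]
      norm_cast at *; omega
    have := linearMap_eq_of_degree_lt (L := L ∘ₗ LinearMap.mulLeft ℝ (X ^ 2 * p)) (L' := 0)
      (N := 2 * n + 1 - p.natDegree) (f := q) ?_ hqd
    · simpa [mul_assoc] using this
    · intro i hi
      -- The exponent is shared out: `X ^ j * p` stays isotropic within the degree bound, and `X ^
      -- l` remains an admissible test polynomial.
      obtain ⟨j, l, hijl, hj, hl⟩ : ∃ j l, i = j + l ∧ p.natDegree + j < n + 1 ∧ l < n + 1 := by
        rcases le_or_gt i (n - p.natDegree) with h | h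
        · exact ⟨i, 0, by omega, by omega, by omega⟩
        · exact ⟨n - p.natDegree, i - (n - p.natDegree), by omega, by omega, by omega⟩
      have h1 := X_mul_orthogonal L hT (f := X ^ j * p) (g := X ^ l) ?_ ?_ (hiso j hj)
      · rw [LinearMap.comp_apply, LinearMap.mulLeft_apply, LinearMap.zero_apply, ← h1, hijl]
        congr 1; ring
      · rw [degree_mul, degree_X_pow, degree_eq_natDegree hp0]; norm_cast; omega
      · rw [degree_X_pow]; exact_mod_cast hl
  obtain ⟨S, w, hS, hw, hmem, hL⟩ := exists_quadrature
    (L ∘ₗ LinearMap.mulLeft ℝ (X ^ 2 : ℝ[X])) (p := p) (N := 2 * n + 1) hp0 (by omega)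
    horth (fun f hf hfd => by
      have := hmin f hf hfd
      rw [LinearMap.comp_apply, LinearMap.mulLeft_apply]
      convert this using 2; ring)
  simp only [LinearMap.comp_apply, LinearMap.mulLeft_apply] at hL
  -- The isotropic `c` vanishes at every node by positivity of the weights, but not at `0`.
  have h0S : (0 : ℝ) ∉ S := by
    intro h0
    have h1 := hL (c * c) (degree_mul_self_lt hcd)
    rw [show X ^ 2 * (c * c) = X * c * (X * c) by ring, hc] at h1
    have h2 := (Finset.sum_eq_zero_iff_of_nonneg (fun a ha => by
      rw [eval_mul]; exact mul_nonneg (hw a ha).le (mul_self_nonneg _))).1 h1.symm 0 h0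
    rw [eval_mul, ← coeff_zero_eq_eval_zero] at h2
    exact (mul_ne_zero (hw 0 h0).ne' (mul_self_ne_zero.2 hc0)) h2
  have hp00 : p.coeff 0 ≠ 0 := by
    intro h
    exact h0S ((hmem 0).2 (by rwa [IsRoot, ← coeff_zero_eq_eval_zero]))
  have hSne : ∀ a ∈ S, a ≠ 0 := fun a ha h => h0S (h ▸ ha)
  -- Dividing by `a ^ 2` undoes the factor `X ^ 2`; `m` and `x` then correct the moments of order
  -- zero and one.
  set W : ℝ → ℝ := fun a => w a / a ^ 2 with hW
  set m := L 1 - ∑ a ∈ S, W a with hm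
  set x := ∑ a ∈ S, W a * a - L X with hx
  have hquad : ∀ f : ℝ[X], f.degree < (2 * (n + 1) + 1 : ℕ) →
      shiftFirst L x f = ∑ a ∈ S, W a * f.eval a + m * f.eval 0 := by
    intro f hf
    obtain ⟨q, hq, hfq⟩ := exists_eq_add_X_sq_mul f
      (show f.degree < ((2 * n + 1) + 2 : ℕ) from hf)
    have e1 : L f = f.coeff 0 * L 1 + f.coeff 1 * L X + ∑ a ∈ S, w a * q.eval a := by
      conv_lhs => rw [hfq]
      rw [map_add, map_add, hL q hq, ← mul_one (C (f.coeff 0)), ← smul_eq_C_mul, ← smul_eq_C_mul,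
        map_smul, map_smul, smul_eq_mul, smul_eq_mul]
    have e2 : ∑ a ∈ S, W a * f.eval a = f.coeff 0 * ∑ a ∈ S, W a + f.coeff 1 * ∑ a ∈ S, W a * a
        + ∑ a ∈ S, w a * q.eval a := by
      rw [Finset.mul_sum, Finset.mul_sum, ← Finset.sum_add_distrib, ← Finset.sum_add_distrib]
      refine Finset.sum_congr rfl fun a ha => ?_
      have := hSne a ha
      conv_lhs => rw [hfq]
      simp only [eval_add, eval_mul, eval_C, eval_X, eval_pow, hW]
      field_simp
    rw [shiftFirst_apply, e1, e2, ← coeff_zero_eq_eval_zero]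
    ring
  have hgg : ∀ g : ℝ[X], g.degree < (n + 2 : ℕ) → g.coeff 1 = 0 →
      L (g * g) = ∑ a ∈ S, W a * (g.eval a * g.eval a) + m * (g.coeff 0 * g.coeff 0) := by
    intro g hg hg1
    have := hquad (g * g) (degree_mul_self_lt hg)
    rw [shiftFirst_apply, coeff_one_mul, hg1] at this
    simp only [eval_mul, ← coeff_zero_eq_eval_zero] at this
    linarith
  have hWpos : ∀ a ∈ S, 0 < W a := fun a ha => div_pos (hw a ha) (by have := hSne a ha; positivity)
  have hm0 : 0 ≤ m := by
    -- A multiple of `p` kills all the nodes, so `L (g * g)` reduces to the mass at `0` times `g(0)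
    -- ^ 2`.
    obtain ⟨g, ⟨u, hgu⟩, hgd, hgc1, hgc0⟩ := exists_dvd_coeff_one_eq_zero hpk hp00
    have h1 := hG g hgd hgc1
    rw [hgg g hgd hgc1, Finset.sum_eq_zero, zero_add] at h1
    · exact nonneg_of_mul_nonneg_left h1 (mul_self_pos.2 hgc0)
    · intro a ha
      have : p.eval a = 0 := (hmem a).1 ha
      rw [hgu, eval_mul, this]; ring
  refine ⟨p, hp0, hpk, hp, hmin, x, m, S, W, hS, hWpos, h0S, hm0, hquad, ?_⟩
  rintro ⟨g, hgd, hg1, hg0, hgL⟩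
  rw [hgg g hgd hg1] at hgL
  have h1 : 0 ≤ ∑ a ∈ S, W a * (g.eval a * g.eval a) :=
    Finset.sum_nonneg fun a ha => mul_nonneg (hWpos a ha).le (mul_self_nonneg _)
  have h2 : 0 ≤ m * (g.coeff 0 * g.coeff 0) := mul_nonneg hm0 (mul_self_nonneg _)
  have h3 : m * (g.coeff 0 * g.coeff 0) = 0 := by linarith
  exact (mul_eq_zero.1 h3).resolve_right (mul_self_ne_zero.2 hg0)

/-! ### Moment matrices in terms of polynomials -/

/-- All exponents of `f` lie in the range of `e`. -/
def SupportedOn {ι : Type*} (e : ι → ℕ) (f : ℝ[X]) : Prop :=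
  ∀ i, f.coeff i ≠ 0 → i ∈ Set.range e

section

variable {ι : Type*} [Fintype ι] {s : ℕ → ℝ} {e : ι → ℕ}

theorem supportedOn_expPoly (e : ι → ℕ) (v : ι → ℝ) : SupportedOn e (expPoly e v) := by
  classical
  intro i hi
  by_contra h
  apply hi
  rw [expPoly, finsetSum_coeff]
  refine Finset.sum_eq_zero fun j _ => ?_
  rw [coeff_monomial, if_neg]
  rintro rfl
  exact h ⟨j, rfl⟩

theorem SupportedOn.exists_expPoly (he : Function.Injective e) {f : ℝ[X]}
    (hf : SupportedOn e f) : ∃ v, expPoly e v = f :=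
  ⟨_, expPoly_coeff he hf⟩

theorem momentMatrix_posSemidef_iff_supportedOn (he : Function.Injective e) :
    (momentMatrix s e).PosSemidef ↔
      ∀ f, SupportedOn e f → 0 ≤ momentFunctional s (f * f) := by
  rw [momentMatrix_posSemidef_iff]
  constructor
  · intro h f hf
    obtain ⟨v, rfl⟩ := hf.exists_expPoly he
    exact h v
  · exact fun h v => h _ (supportedOn_expPoly e v)

theorem momentMatrix_posDef_iff_supportedOn (he : Function.Injective e) :
    (momentMatrix s e).PosDef ↔
      ∀ f, f ≠ 0 → SupportedOn e f → 0 < momentFunctional s (f * f) := by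
  rw [momentMatrix_posDef_iff]
  constructor
  · intro h f hf0 hf
    obtain ⟨v, rfl⟩ := hf.exists_expPoly he
    exact h v fun hv => hf0 (by simp [hv, expPoly])
  · exact fun h v hv => h _ (expPoly_ne_zero he hv) (supportedOn_expPoly e v)

/-- For a semidefinite moment matrix the kernel vectors are the coefficient vectors of isotropic
polynomials, which turns the rank criterion for deleting an index into one about coefficients. -/
theorem rank_momentMatrix_comp_eq_iff {κ : Type*} [Fintype κ] (he : Function.Injective e)
    (hM : (momentMatrix s e).PosSemidef) {j : κ → ι} (hj : Function.Injective j) {i : ι}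
    (hi : Set.range j = {i}ᶜ) :
    (momentMatrix s (e ∘ j)).rank = (momentMatrix s e).rank ↔
      ∃ f, SupportedOn e f ∧ f.coeff (e i) ≠ 0 ∧ momentFunctional s (f * f) = 0 := by
  have h0 : ∀ v, (momentMatrix s e).mulVec v = 0 ↔
      momentFunctional s (expPoly e v * expPoly e v) = 0 := by
    intro v
    rw [← hM.dotProduct_mulVec_zero_iff, star_trivial, dotProduct_momentMatrix_mulVec]
  change ((momentMatrix s e).submatrix j j).rank = _ ↔ _
  rw [hM.rank_submatrix_eq_iff hj hi]
  constructor
  · rintro ⟨v, hv, hvi⟩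
    exact ⟨expPoly e v, supportedOn_expPoly e v, by rwa [coeff_expPoly he], (h0 v).1 hv⟩
  · rintro ⟨f, hf, hfi, hL⟩
    obtain ⟨v, rfl⟩ := hf.exists_expPoly he
    exact ⟨v, (h0 v).2 hL, by rwa [coeff_expPoly he] at hfi⟩

end

theorem supportedOn_add_one_iff {n : ℕ} {f : ℝ[X]} :
    SupportedOn (fun i : Fin n => (i : ℕ) + 1) f ↔ ∃ q : ℝ[X], q.degree < n ∧ f = X * q := by
  constructor
  · intro h
    have h0 : f.coeff 0 = 0 := by
      by_contra h0
      obtain ⟨i, hi⟩ := h 0 h0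
      simp at hi
    refine ⟨f.divX, ?_, ?_⟩
    · rw [degree_lt_iff_coeff_zero]
      intro i hi
      rw [coeff_divX]
      by_contra hne
      obtain ⟨j, hj⟩ := h _ hne
      have := j.2
      simp at hj; omega
    · conv_lhs => rw [← X_mul_divX_add f, h0, C_0, add_zero]
  · rintro ⟨q, hq, rfl⟩ i hi
    rcases i with _ | i
    · simp at hi
    · rw [coeff_X_mul] at hi
      rw [degree_lt_iff_coeff_zero] at hq
      exact ⟨⟨i, by by_contra h; exact hi (hq i (by omega))⟩, rfl⟩

/-- The exponents `0, 2, 3, …, m + 1`. -/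
def gapExp (m : ℕ) : Unit ⊕ Fin m → ℕ := Sum.elim (fun _ => 0) fun j => (j : ℕ) + 2

theorem gapExp_injective (m : ℕ) : Function.Injective (gapExp m) := by
  rintro (_ | i) (_ | j) h
  · rfl
  · simp [gapExp] at h
  · simp [gapExp] at h
  · simpa [gapExp, Fin.ext_iff] using h

theorem add_one_injective (n : ℕ) : Function.Injective fun i : Fin n => (i : ℕ) + 1 :=
  fun i j h => by simpa [Fin.ext_iff] using h

theorem supportedOn_gapExp_iff {m : ℕ} {f : ℝ[X]} :
    SupportedOn (gapExp m) f ↔ f.degree < (m + 2 : ℕ) ∧ f.coeff 1 = 0 := by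
  constructor
  · intro h
    constructor
    · rw [degree_lt_iff_coeff_zero]
      intro i hi
      by_contra hne
      obtain ⟨j | j, hj⟩ := h _ hne
      · simp [gapExp] at hj; omega
      · have := j.2
        simp [gapExp] at hj; omega
    · by_contra hne
      obtain ⟨j | j, hj⟩ := h _ hne <;> simp [gapExp] at hj
  · rintro ⟨hd, h1⟩ i hi
    rw [degree_lt_iff_coeff_zero] at hd
    rcases i with _ | _ | i
    · exact ⟨Sum.inl (), rfl⟩
    · exact absurd h1 hi
    · exact ⟨Sum.inr ⟨i, by by_contra h; exact hi (hd _ (by omega))⟩, rfl⟩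

/-! ### The matrices of the theorem as moment matrices -/

section

variable (β : ℕ → ℝ) (x : ℝ)

theorem fillOne_of_ne {i : ℕ} (hi : i ≠ 1) : fillOne β x i = β i := if_neg hi

/-- The filler `x` is arbitrary because exponents starting at `1` never sum to `1`. This freedom
lets matrix conditions be read with whichever first moment is at hand. -/
theorem hankelTilde_eq (k : ℕ) :
    hankelTilde β k = momentMatrix (fillOne β x) fun i : Fin k => (i : ℕ) + 1 := by
  ext i j
  simp only [hankelTilde, hankel, tail, momentMatrix, Matrix.of_apply]
  rw [fillOne_of_ne _ _ (by omega)]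
  congr 1; ring

theorem hankelHat_eq (n : ℕ) : hankelHat β (n + 2) =
    momentMatrix (fillOne β x) ((fun i : Fin (n + 2) => (i : ℕ) + 1) ∘ Fin.castSucc) :=
  hankelTilde_eq β x (n + 1)

theorem hankelBreve_eq (n : ℕ) : hankelBreve β (n + 2) =
    momentMatrix (fillOne β x) ((fun i : Fin (n + 2) => (i : ℕ) + 1) ∘ Fin.succ) := by
  ext i j
  simp only [hankelBreve, hankel, tail, momentMatrix, Matrix.of_apply, Function.comp, Fin.val_succ]
  rw [fillOne_of_ne _ _ (by omega)]
  congr 1; ring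

theorem bordered_eq (m : ℕ) :
    bordered (β 0) (fun j : Fin m => β ((j : ℕ) + 2)) (hankel (tail 4 β) m) =
      momentMatrix (fillOne β x) (gapExp m) := by
  ext (i | i) (j | j) <;>
    simp only [bordered, hankel, tail, momentMatrix, Matrix.of_apply, gapExp, Sum.elim_inl,
      Sum.elim_inr, Matrix.fromBlocks_apply₁₁, Matrix.fromBlocks_apply₁₂,
      Matrix.fromBlocks_apply₂₁, Matrix.fromBlocks_apply₂₂, Matrix.replicateRow_apply,
      Matrix.replicateCol_apply] <;>
    rw [fillOne_of_ne _ _ (by omega)] <;> congr 1 <;> ring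

theorem matHat_eq (n : ℕ) :
    matHat β (n + 2) = momentMatrix (fillOne β x) (gapExp (n + 1)) :=
  bordered_eq β x (n + 1)

theorem matTilde_eq (n : ℕ) :
    matTilde β (n + 2) = momentMatrix (fillOne β x) (gapExp n) :=
  bordered_eq β x n

theorem hankelTilde_posSemidef_iff (k : ℕ) : (hankelTilde β k).PosSemidef ↔
    ∀ f : ℝ[X], f.degree < k → 0 ≤ momentFunctional (fillOne β x) (X * f * (X * f)) := by
  rw [hankelTilde_eq β x, momentMatrix_posSemidef_iff_supportedOn (add_one_injective k)]
  simp only [supportedOn_add_one_iff]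
  exact ⟨fun h f hf => h _ ⟨f, hf, rfl⟩, by rintro h _ ⟨f, hf, rfl⟩; exact h f hf⟩

theorem hankelTilde_posDef_iff (k : ℕ) : (hankelTilde β k).PosDef ↔
    ∀ f : ℝ[X], f ≠ 0 → f.degree < k →
      0 < momentFunctional (fillOne β x) (X * f * (X * f)) := by
  rw [hankelTilde_eq β x, momentMatrix_posDef_iff_supportedOn (add_one_injective k)]
  simp only [supportedOn_add_one_iff]
  constructor
  · exact fun h f hf0 hf => h _ (mul_ne_zero X_ne_zero hf0) ⟨f, hf, rfl⟩
  · rintro h _ h0 ⟨f, hf, rfl⟩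
    exact h f (right_ne_zero_of_mul h0) hf

theorem matHat_posSemidef_iff (n : ℕ) : (matHat β (n + 2)).PosSemidef ↔
    ∀ g : ℝ[X], g.degree < (n + 3 : ℕ) → g.coeff 1 = 0 →
      0 ≤ momentFunctional (fillOne β x) (g * g) := by
  rw [matHat_eq β x, momentMatrix_posSemidef_iff_supportedOn (gapExp_injective _)]
  simp only [supportedOn_gapExp_iff, and_imp]

theorem matTilde_posDef_iff (n : ℕ) : (matTilde β (n + 2)).PosDef ↔
    ∀ g : ℝ[X], g ≠ 0 → g.degree < (n + 2 : ℕ) → g.coeff 1 = 0 →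
      0 < momentFunctional (fillOne β x) (g * g) := by
  rw [matTilde_eq β x, momentMatrix_posDef_iff_supportedOn (gapExp_injective _)]
  simp only [supportedOn_gapExp_iff, and_imp]

/-- `hankelHat` and `hankelBreve` arise from `hankelTilde` by deleting the last and the first index,
so the two rank equalities concern the top and the constant coefficient of isotropic polynomials. -/
theorem ranksAgree_iff (n : ℕ) (hT : (hankelTilde β (n + 2)).PosSemidef) :
    RanksAgree β (n + 2) ↔
      (∃ f : ℝ[X], f.degree < (n + 2 : ℕ) ∧ f.coeff (n + 1) ≠ 0 ∧
        momentFunctional (fillOne β x) (X * f * (X * f)) = 0) ∧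
      (∃ f : ℝ[X], f.degree < (n + 2 : ℕ) ∧ f.coeff 0 ≠ 0 ∧
        momentFunctional (fillOne β x) (X * f * (X * f)) = 0) := by
  rw [hankelTilde_eq β x] at hT
  rw [RanksAgree, eq_comm (a := (hankelTilde β (n + 2)).rank), hankelHat_eq β x,
    hankelBreve_eq β x, hankelTilde_eq β x,
    rank_momentMatrix_comp_eq_iff (add_one_injective _) hT (Fin.castSucc_injective _)
      (i := Fin.last (n + 1)) (by ext i; simp [Fin.ext_iff]; omega),
    rank_momentMatrix_comp_eq_iff (add_one_injective _) hT (Fin.succ_injective _)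
      (i := 0) (by ext i; simp)]
  simp only [supportedOn_add_one_iff]
  refine and_congr ?_ ?_
  · constructor
    · rintro ⟨_, ⟨f, hf, rfl⟩, h1, h2⟩
      exact ⟨f, hf, by simpa [coeff_X_mul] using h1, h2⟩
    · rintro ⟨f, hf, h1, h2⟩
      exact ⟨_, ⟨f, hf, rfl⟩, by simpa [coeff_X_mul] using h1, h2⟩
  · constructor
    · rintro ⟨_, ⟨f, hf, rfl⟩, h1, h2⟩
      exact ⟨f, hf, by rw [Fin.val_zero, coeff_X_mul] at h1; exact h1, h2⟩
    · rintro ⟨f, hf, h1, h2⟩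
      exact ⟨_, ⟨f, hf, rfl⟩, by rw [Fin.val_zero, coeff_X_mul]; exact h1, h2⟩

/-- Under `RanksAgree` the left rank may be replaced by that of `hankelBreve`, which is `matHat`
with the index of the exponent `0` deleted. -/
theorem rank_lt_rank_matHat_iff (n : ℕ) (hG : (matHat β (n + 2)).PosSemidef)
    (hR : RanksAgree β (n + 2)) :
    (hankelHat β (n + 2)).rank < (matHat β (n + 2)).rank ↔
      ¬ ∃ g : ℝ[X], g.degree < (n + 3 : ℕ) ∧ g.coeff 1 = 0 ∧ g.coeff 0 ≠ 0 ∧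
        momentFunctional (fillOne β x) (g * g) = 0 := by
  have h1 : hankelBreve β (n + 2) = momentMatrix (fillOne β x) (gapExp (n + 1) ∘ Sum.inr) := by
    rw [hankelBreve_eq β x]; rfl
  have hle : (hankelBreve β (n + 2)).rank ≤ (matHat β (n + 2)).rank :=
    (matHat β (n + 2)).rank_submatrix_le Sum.inr Sum.inr
  rw [hR.1, hR.2, lt_iff_le_and_ne, and_iff_right hle, ne_eq, h1, matHat_eq β x]
  rw [matHat_eq β x] at hG
  rw [rank_momentMatrix_comp_eq_iff (gapExp_injective _) hG Sum.inr_injective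
    (i := Sum.inl ()) (by ext (i | i) <;> simp)]
  simp only [supportedOn_gapExp_iff, and_assoc]
  rfl

/-! ### Partial positive semidefiniteness -/

theorem IsPartialPosSemidef.momentMatrix_posSemidef {k : ℕ}
    (h : IsPartialPosSemidef (partialHankel β (k + 1))) {ι : Type*} (e : ι → ℕ)
    (hek : ∀ i, e i ≤ k) (he : ∀ i j, e i + e j ≠ 1) :
    (momentMatrix (fillOne β x) e).PosSemidef := by
  set e' : ι → Fin (k + 1) := fun i => ⟨e i, Nat.lt_succ_of_le (hek i)⟩
  have h1 := h.2 (Set.range e') (Matrix.of fun i j => β ((i : Fin (k + 1)) + (j : Fin (k + 1)))) ?_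
  · convert h1.submatrix (Set.rangeFactorization e') using 1
    ext i j
    exact fillOne_of_ne _ _ (he i j)
  · rintro ⟨_, i, rfl⟩ ⟨_, j, rfl⟩
    exact if_neg (he i j)

theorem isPartialPosSemidef_of_nonneg (k : ℕ)
    (h : ∀ f : ℝ[X], f.degree < (k + 1 : ℕ) → 0 ≤ momentFunctional (fillOne β x) (f * f)) :
    IsPartialPosSemidef (partialHankel β (k + 1)) := by
  constructor
  · ext i j; simp [partialHankel, add_comm]
  · intro S B hB
    have hfull : (momentMatrix (fillOne β x) fun i : Fin (k + 1) => (i : ℕ)).PosSemidef := by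
      rw [momentMatrix_posSemidef_iff_supportedOn Fin.val_injective]
      intro f hf
      apply h
      rw [degree_lt_iff_coeff_zero]
      intro i hi
      by_contra hne
      obtain ⟨j, rfl⟩ := hf i hne
      have := j.2
      omega
    convert hfull.submatrix (Subtype.val : S → Fin (k + 1)) using 1
    ext i j
    have h1 := hB i j
    simp only [partialHankel, gapOne, Matrix.of_apply] at h1
    split_ifs at h1 with h2
    simp only [Option.some.injEq] at h1
    rw [← h1]
    exact (fillOne_of_ne _ _ h2).symm

end

/-! ### The rank of a sequence -/

theorem exists_mulVec_of_mem_span_col {n : ℕ} (M : Matrix (Fin n) (Fin n) ℝ) {J : Set (Fin n)}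
    {y : Fin n → ℝ} (hy : y ∈ Submodule.span ℝ (M.col '' J)) :
    ∃ v : Fin n → ℝ, (∀ j ∉ J, v j = 0) ∧ M.mulVec v = y := by
  induction hy using Submodule.span_induction with
  | mem y hy =>
    obtain ⟨j, hj, rfl⟩ := hy
    refine ⟨Pi.single j 1, fun i hi => ?_, by simp⟩
    exact Pi.single_eq_of_ne (fun h => hi (by rw [h]; exact hj)) _
  | zero => exact ⟨0, by simp, by simp⟩
  | add y z _ _ hy hz =>
    obtain ⟨v, hv, rfl⟩ := hy
    obtain ⟨w, hw, rfl⟩ := hz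
    exact ⟨v + w, fun j hj => by simp [hv j hj, hw j hj], Matrix.mulVec_add _ _ _⟩
  | smul c y _ hy =>
    obtain ⟨v, hv, rfl⟩ := hy
    exact ⟨c • v, fun j hj => by simp [hv j hj], Matrix.mulVec_smul _ _ _⟩

theorem hankel_mulVec_eq_zero_iff (s : ℕ → ℝ) (k : ℕ) (v : Fin k → ℝ) :
    (hankel s k).mulVec v = 0 ↔ ∀ q : ℝ[X], q.degree < k →
      momentFunctional s (expPoly (fun i : Fin k => (i : ℕ)) v * q) = 0 := by
  change (momentMatrix s fun i : Fin k => (i : ℕ)).mulVec v = 0 ↔ _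
  rw [momentMatrix_mulVec_eq_zero_iff]
  constructor
  · intro h q hq
    obtain ⟨w, rfl⟩ := SupportedOn.exists_expPoly (e := fun i : Fin k => (i : ℕ))
      Fin.val_injective (f := q) (fun i hi => by
        rw [degree_lt_iff_coeff_zero] at hq
        exact ⟨⟨i, by by_contra h; exact hi (hq i (by omega))⟩, rfl⟩)
    exact h w
  · intro h w
    apply h
    rw [degree_lt_iff_coeff_zero]
    intro i hi
    by_contra hne
    obtain ⟨j, rfl⟩ := supportedOn_expPoly _ w i hne
    exact absurd j.2 (not_lt.2 hi)

/-- The rank of a singular sequence is the least degree of a polynomial in the kernel of its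
Hankel matrix. -/
theorem seqRank_eq_natDegree (s : ℕ → ℝ) {k : ℕ} {p : ℝ[X]} (hp0 : p ≠ 0) (hpk : p.degree < k)
    (hp : ∀ q : ℝ[X], q.degree < k → momentFunctional s (p * q) = 0)
    (hmin : ∀ f : ℝ[X], f ≠ 0 → f.degree < p.natDegree →
      ∃ q : ℝ[X], q.degree < k ∧ momentFunctional s (f * q) ≠ 0) :
    seqRank s k = p.natDegree := by
  have hpn : p.natDegree < k := by
    rw [degree_eq_natDegree hp0] at hpk; exact_mod_cast hpk
  have hpv : expPoly (fun i : Fin k => (i : ℕ)) (fun i => p.coeff i) = p :=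
    expPoly_coeff Fin.val_injective fun i hi => by
      rw [degree_lt_iff_coeff_zero] at hpk
      exact ⟨⟨i, by by_contra h; exact hi (hpk i (by omega))⟩, rfl⟩
  have hker : (hankel s k).mulVec (fun i => p.coeff i) = 0 := by
    rw [hankel_mulVec_eq_zero_iff, hpv]; exact hp
  have hdet : (hankel s k).det = 0 := by
    rw [← Matrix.exists_mulVec_eq_zero_iff]
    refine ⟨_, fun h => hp0 ?_, hker⟩
    rw [← hpv, h]; simp [expPoly]
  rw [seqRank, if_neg (by simpa using hdet)]
  apply IsLeast.csInf_eq
  constructor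
  · refine ⟨hpn, ?_⟩
    have hlc : p.coeff p.natDegree ≠ 0 := by
      rw [coeff_natDegree]; exact leadingCoeff_ne_zero.2 hp0
    simp only [Matrix.mulVec_eq_sum, op_smul_eq_smul] at hker
    set r : Fin k := ⟨p.natDegree, hpn⟩
    rw [← Finset.add_sum_erase _ _ (Finset.mem_univ r), add_eq_zero_iff_eq_neg] at hker
    have : (hankel s k).col r = (p.coeff p.natDegree)⁻¹ • ((p.coeff p.natDegree) •
        (hankel s k).col r) := by rw [smul_smul, inv_mul_cancel₀ hlc, one_smul]
    rw [this]
    apply Submodule.smul_mem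
    have h2 : (p.coeff p.natDegree) • (hankel s k).col r =
      -∑ j ∈ Finset.univ.erase r, p.coeff j • (hankel s k).col j := by
      exact hker
    rw [h2]
    refine Submodule.neg_mem _ (Submodule.sum_mem _ fun j hj => ?_)
    by_cases hjr : (j : ℕ) < p.natDegree
    · exact Submodule.smul_mem _ _ (Submodule.subset_span ⟨j, hjr, rfl⟩)
    · have hne : (j : ℕ) ≠ p.natDegree := fun h => (Finset.mem_erase.1 hj).1 (Fin.ext h)
      rw [coeff_eq_zero_of_natDegree_lt (by omega), zero_smul]
      exact Submodule.zero_mem _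
  · rintro i ⟨hi, hmem⟩
    by_contra! hlt
    obtain ⟨v, hv, hvi⟩ := exists_mulVec_of_mem_span_col _ hmem
    -- A column dependence at index `i` is a kernel polynomial of degree `i` with leading
    -- coefficient one, contradicting minimality of `p`.
    set u : Fin k → ℝ := Pi.single ⟨i, hi⟩ 1 - v with hu
    have hu0 : (hankel s k).mulVec u = 0 := by
      rw [hu, Matrix.mulVec_sub, hvi]; simp
    have hui : u ⟨i, hi⟩ = 1 := by
      rw [hu, Pi.sub_apply, hv _ (by simp)]; simp
    have huj : ∀ j : Fin k, i < j → u j = 0 := by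
      intro j hj
      rw [hu, Pi.sub_apply, hv _ (by simp; omega),
        Pi.single_eq_of_ne (fun h => by rw [h] at hj; simp at hj)]
      simp
    obtain ⟨q, hq, hne⟩ := hmin (expPoly (fun i : Fin k => (i : ℕ)) u)
      (expPoly_ne_zero Fin.val_injective fun h => by simp [h] at hui) (by
        rw [degree_lt_iff_coeff_zero]
        intro j hj
        by_contra hne
        obtain ⟨l, rfl⟩ := supportedOn_expPoly _ u j hne
        rw [coeff_expPoly Fin.val_injective] at hne
        exact hne (huj l (hlt.trans_le hj)))
    exact hne ((hankel_mulVec_eq_zero_iff s k u).1 hu0 q hq)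

/-! ### Representing measures -/

theorem IsRepresenting.integrable_and_integral_eval {μ : Measure ℝ} {s : ℕ → ℝ} {d : ℕ}
    (h : IsRepresenting μ s d) {f : ℝ[X]} (hf : f.degree < (d + 1 : ℕ)) :
    Integrable (fun t => f.eval t) μ ∧ ∫ t, f.eval t ∂μ = momentFunctional s f := by
  have hle : ∀ i ∈ f.support, i ≤ d := by
    intro i hi
    rw [degree_lt_iff_coeff_zero] at hf
    by_contra! hlt
    exact mem_support_iff.1 hi (hf i hlt)
  have hint : ∀ i ∈ f.support, Integrable (fun t : ℝ => f.coeff i * t ^ i) μ :=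
    fun i hi => (h i (hle i hi)).1.const_mul _
  simp only [eval_eq_sum, Polynomial.sum]
  refine ⟨integrable_finsetSum _ hint, ?_⟩
  rw [integral_finsetSum _ hint, momentFunctional_apply, Polynomial.sum]
  refine Finset.sum_congr rfl fun i hi => ?_
  rw [integral_const_mul, (h i (hle i hi)).2, mul_comm]

theorem IsRepresenting.momentFunctional_mul_self {μ : Measure ℝ} {s : ℕ → ℝ} {k : ℕ}
    (h : IsRepresenting μ s (2 * k)) {f : ℝ[X]} (hf : f.degree < (k + 1 : ℕ)) :
    0 ≤ momentFunctional s (f * f) ∧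
      (momentFunctional s (f * f) = 0 ↔ ∀ᵐ t ∂μ, f.eval t = 0) := by
  obtain ⟨hi, hL⟩ := h.integrable_and_integral_eval (degree_mul_self_lt hf)
  have hnn : 0 ≤ fun t => (f * f).eval t := fun t => by
    simp only [eval_mul]; exact mul_self_nonneg _
  rw [← hL]
  refine ⟨integral_nonneg hnn, ?_⟩
  rw [integral_eq_zero_iff_of_nonneg hnn hi]
  refine Filter.eventually_congr (Filter.Eventually.of_forall fun t => ?_)
  simp

theorem integrable_and_integral_sum_dirac (S : Finset ℝ) (w : ℝ → ℝ) (hw : ∀ a ∈ S, 0 < w a)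
    (f : ℝ → ℝ) :
    Integrable f (∑ a ∈ S, ENNReal.ofReal (w a) • Measure.dirac a) ∧
      ∫ t, f t ∂(∑ a ∈ S, ENNReal.ofReal (w a) • Measure.dirac a) = ∑ a ∈ S, w a * f a := by
  have hi : ∀ a ∈ S, Integrable f (ENNReal.ofReal (w a) • Measure.dirac a) := fun a _ =>
    (integrable_dirac (by simp)).smul_measure ENNReal.ofReal_ne_top
  refine ⟨integrable_finsetSum_measure.2 hi, ?_⟩
  rw [integral_finsetSum_measure hi]
  refine Finset.sum_congr rfl fun a ha => ?_
  rw [integral_smul_measure, integral_dirac, ENNReal.toReal_ofReal (hw a ha).le, smul_eq_mul]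

theorem exists_isAtomic_of_quadrature {s : ℕ → ℝ} {d : ℕ} (S : Finset ℝ) (w : ℝ → ℝ)
    (hw : ∀ a ∈ S, 0 < w a)
    (h : ∀ f : ℝ[X], f.degree < (d + 1 : ℕ) → momentFunctional s f = ∑ a ∈ S, w a * f.eval a) :
    ∃ μ : Measure ℝ, IsRepresenting μ s d ∧ IsAtomic μ S.card := by
  refine ⟨_, fun i hi => ?_, S, w, rfl, hw, rfl⟩
  obtain ⟨h1, h2⟩ := integrable_and_integral_sum_dirac S w hw (fun t => t ^ i)
  refine ⟨h1, h2.trans ?_⟩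
  have := h (X ^ i) (by rw [degree_X_pow]; norm_cast; omega)
  rw [momentFunctional_X_pow] at this
  simp [this]

theorem momentFunctional_fillOne_eq_shiftFirst (β : ℕ → ℝ) (x : ℝ) :
    momentFunctional (fillOne β x) = shiftFirst (momentFunctional (fillOne β 0)) x :=
  LinearMap.ext fun f => momentFunctional_fillOne β x f

theorem tail_two_fillOne (β : ℕ → ℝ) (x : ℝ) : tail 2 (fillOne β x) = tail 2 β := by
  ext i; exact fillOne_of_ne _ _ (by omega)

/-- The rank of a positive semidefinite sequence `(β_2, …, β_{2k})` in terms of the isotropic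
polynomials of its Hankel matrix. -/
theorem rankTilde_eq_natDegree {β : ℕ → ℝ} {k : ℕ} (hT : (hankelTilde β k).PosSemidef) (x : ℝ)
    {p : ℝ[X]} (hp0 : p ≠ 0) (hpk : p.degree < k)
    (hp : momentFunctional (fillOne β x) (X * p * (X * p)) = 0)
    (hmin : ∀ f : ℝ[X], f ≠ 0 → f.degree < p.natDegree →
      0 < momentFunctional (fillOne β x) (X * f * (X * f))) :
    rankTilde β k = p.natDegree := by
  rw [hankelTilde_posSemidef_iff β x] at hT
  have htail : ∀ f q : ℝ[X], momentFunctional (tail 2 β) (f * q) =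
      momentFunctional (fillOne β x) (X * f * (X * q)) := by
    intro f q
    rw [← tail_two_fillOne β x, momentFunctional_tail]
    congr 1; ring
  apply seqRank_eq_natDegree _ hp0 hpk
  · intro q hq
    rw [htail]; exact X_mul_orthogonal _ hT hpk hq hp
  · intro f hf0 hf
    rw [degree_eq_natDegree hp0] at hpk
    refine ⟨f, hf.trans hpk, ?_⟩
    rw [htail]; exact (hmin f hf0 hf).ne'

theorem rankTilde_eq_of_posDef {β : ℕ → ℝ} {k : ℕ} (hT : (hankelTilde β k).PosDef) :
    rankTilde β k = k :=
  if_pos hT.det_pos.ne'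

/-! ### From matrix conditions to atomic measures and back -/

section

variable {β : ℕ → ℝ} {n : ℕ}

/-- The index sets `{1, …, k}` and `{0, 2, …, k}`, with `k = n + 2`, both avoid the unspecified
entry. -/
theorem posSemidef_of_isPartialPosSemidef
    (h : IsPartialPosSemidef (partialHankel β (n + 3))) :
    (hankelTilde β (n + 2)).PosSemidef ∧ (matHat β (n + 2)).PosSemidef := by
  rw [hankelTilde_eq β 0, matHat_eq β 0]
  constructor <;> apply h.momentMatrix_posSemidef
  · intro i; have := i.2; omega
  · intro i j; omega
  · rintro (i | i)
    · simp [gapExp]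
    · have := i.2; simp [gapExp]; omega
  · rintro (i | i) (j | j) <;> simp [gapExp]
    omega

theorem exists_isAtomic_of_posDef (hT : (hankelTilde β (n + 2)).PosDef)
    (hG : (matHat β (n + 2)).PosSemidef) (hG' : (matTilde β (n + 2)).PosDef) :
    ∃ (x : ℝ) (μ : Measure ℝ), IsRepresenting μ (fillOne β x) (2 * (n + 2)) ∧
      IsAtomic μ (rankTilde β (n + 2)) := by
  obtain ⟨x, S, w, hS, hw, h⟩ := exists_quadrature_of_posDef
    (momentFunctional (fillOne β 0)) ((hankelTilde_posDef_iff β 0 _).1 hT)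
    ((matHat_posSemidef_iff β 0 n).1 hG) ((matTilde_posDef_iff β 0 n).1 hG')
  rw [← momentFunctional_fillOne_eq_shiftFirst] at h
  obtain ⟨μ, h1, h2⟩ := exists_isAtomic_of_quadrature S w hw h
  exact ⟨x, μ, h1, by rwa [rankTilde_eq_of_posDef hT, ← hS]⟩

/-- The extra atom is the mass at the origin; it is positive only if no isotropic polynomial without
linear term is nonzero at `0`, which is the strict rank inequality. -/
theorem exists_isAtomic_of_ranksAgree (hT : (hankelTilde β (n + 2)).PosSemidef)
    (hG : (matHat β (n + 2)).PosSemidef) (hR : RanksAgree β (n + 2)) :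
    ∃ (x : ℝ) (μ : Measure ℝ), IsRepresenting μ (fillOne β x) (2 * (n + 2)) ∧
      (IsAtomic μ (rankTilde β (n + 2)) ∨
        (hankelHat β (n + 2)).rank < (matHat β (n + 2)).rank ∧
          IsAtomic μ (rankTilde β (n + 2) + 1)) := by
  obtain ⟨⟨e, hed, hen, he⟩, c, hcd, hc0, hc⟩ := (ranksAgree_iff β 0 n hT).1 hR
  obtain ⟨p, hp0, hpd, hp, hmin, x, m, S, w, hS, hw, h0S, hm, h, hm0⟩ :=
    exists_quadrature_of_isotropic (momentFunctional (fillOne β 0)) (n := n + 1)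
    ((hankelTilde_posSemidef_iff β 0 _).1 hT) ((matHat_posSemidef_iff β 0 n).1 hG)
    hed hen he hcd hc0 hc
  rw [← momentFunctional_fillOne_eq_shiftFirst] at h
  have hr := rankTilde_eq_natDegree hT 0 hp0 hpd hp hmin
  rcases hm.eq_or_lt with hm' | hm'
  · obtain ⟨μ, h1, h2⟩ := exists_isAtomic_of_quadrature (d := 2 * (n + 2)) S w hw
      fun f hf => by rw [h f hf, ← hm', zero_mul, add_zero]
    exact ⟨x, μ, h1, Or.inl (by rwa [hr, ← hS])⟩
  · have hne : ∀ a ∈ S, a ≠ 0 := fun a ha h => h0S (h ▸ ha)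
    have hw' : ∀ a ∈ insert 0 S, 0 < Function.update w 0 m a := by
      intro a ha
      rcases Finset.mem_insert.1 ha with rfl | ha
      · rwa [Function.update_self]
      · rw [Function.update_of_ne (hne a ha)]; exact hw a ha
    obtain ⟨μ, h1, h2⟩ := exists_isAtomic_of_quadrature (d := 2 * (n + 2)) (insert 0 S)
      (Function.update w 0 m) hw' (fun f hf => by
        rw [h f hf, Finset.sum_insert h0S, Function.update_self, add_comm]
        congr 1
        exact Finset.sum_congr rfl fun a ha => by rw [Function.update_of_ne (hne a ha)])
    rw [Finset.card_insert_of_notMem h0S, hS, ← hr] at h2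
    refine ⟨x, μ, h1, Or.inr ⟨?_, h2⟩⟩
    rw [rank_lt_rank_matHat_iff β 0 n hG hR]
    exact fun hg => hm'.ne' (hm0 hg)

/-- With as many atoms as the least isotropic degree, none sits at `0`: otherwise the product over
the other atoms would be isotropic of smaller degree. The node polynomial is then nonzero at `0`,
and a multiple of it without linear term is isotropic. -/
theorem not_rank_lt_of_isAtomic (hT : (hankelTilde β (n + 2)).PosSemidef)
    (hG : (matHat β (n + 2)).PosSemidef) (hR : RanksAgree β (n + 2)) {x : ℝ} {μ : Measure ℝ}
    (hμ : IsRepresenting μ (fillOne β x) (2 * (n + 2))) (ha : IsAtomic μ (rankTilde β (n + 2))) :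
    ¬ (hankelHat β (n + 2)).rank < (matHat β (n + 2)).rank := by
  obtain ⟨⟨e, hed, hen, he⟩, c, hcd, hc0, hc⟩ := (ranksAgree_iff β x n hT).1 hR
  obtain ⟨p, hp0, hpd, hp, hmin, -⟩ :=
    exists_quadrature_of_isotropic (momentFunctional (fillOne β x)) (n := n + 1)
    ((hankelTilde_posSemidef_iff β x _).1 hT) ((matHat_posSemidef_iff β x n).1 hG)
    hed hen he hcd hc0 hc
  have hr := rankTilde_eq_natDegree hT x hp0 hpd hp hmin
  obtain ⟨S, w, hS, hw, rfl⟩ := ha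
  rw [hr] at hS
  have hpn : p.natDegree < n + 2 := by
    rw [degree_eq_natDegree hp0] at hpd; exact_mod_cast hpd
  have hL : ∀ f : ℝ[X], f.degree < (n + 3 : ℕ) → (∀ a ∈ S, f.eval a = 0) →
      momentFunctional (fillOne β x) (f * f) = 0 := by
    intro f hf hf0
    rw [← (hμ.integrable_and_integral_eval (degree_mul_self_lt hf)).2,
      (integrable_and_integral_sum_dirac S w hw _).2]
    exact Finset.sum_eq_zero fun a ha => by rw [eval_mul, hf0 a ha]; ring
  have hdeg : ∀ T : Finset ℝ, (∏ a ∈ T, (X - C a) : ℝ[X]).degree = (T.card : WithBot ℕ) := by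
    intro T
    rw [degree_prod]; simp
  have hroot : ∀ (T : Finset ℝ), ∀ a ∈ T, (∏ b ∈ T, (X - C b) : ℝ[X]).eval a = 0 := by
    intro T a ha
    rw [eval_prod]; exact Finset.prod_eq_zero ha (by simp)
  have h0S : (0 : ℝ) ∉ S := by
    intro h0
    set f : ℝ[X] := ∏ a ∈ S.erase 0, (X - C a) with hf
    have hfd : f.degree < p.natDegree := by
      rw [hf, hdeg, ← hS]; exact_mod_cast Finset.card_erase_lt_of_mem h0
    have hf0 : f ≠ 0 := Finset.prod_ne_zero_iff.2 fun a _ => X_sub_C_ne_zero a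
    refine (hmin f hf0 hfd).ne' (hL _ (degree_X_mul_lt (n := n + 2) ?_) fun a ha => ?_)
    · exact hfd.trans (by exact_mod_cast hpn)
    · rw [eval_mul, eval_X]
      by_cases h : a = 0
      · rw [h, zero_mul]
      · rw [hroot _ a (Finset.mem_erase.2 ⟨h, ha⟩), mul_zero]
  rw [rank_lt_rank_matHat_iff β x n hG hR, not_not]
  obtain ⟨g, ⟨u, hgu⟩, hgd, hg1, hg0⟩ := exists_dvd_coeff_one_eq_zero (n := n + 1)
    (p := ∏ a ∈ S, (X - C a)) (by rw [hdeg, hS]; exact_mod_cast hpn) (by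
      rw [coeff_zero_eq_eval_zero, eval_prod]
      refine Finset.prod_ne_zero_iff.2 fun a ha => ?_
      simpa using fun h : a = 0 => h0S (h ▸ ha))
  refine ⟨g, hgd, hg1, hg0, hL g hgd fun a ha => ?_⟩
  rw [hgu, eval_mul, hroot S a ha, zero_mul]

/-- Isotropy means vanishing almost everywhere. If `g` vanishes almost everywhere then so does `X *
g`, so definiteness of `hankelTilde` passes to `matTilde`. -/
theorem conditions_of_isRepresenting {x : ℝ} {μ : Measure ℝ}
    (hμ : IsRepresenting μ (fillOne β x) (2 * (n + 2))) :
    IsPartialPosSemidef (partialHankel β (n + 3)) ∧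
      (((hankelTilde β (n + 2)).PosDef ∧ (matTilde β (n + 2)).PosDef) ∨
        RanksAgree β (n + 2)) := by
  have hpart : IsPartialPosSemidef (partialHankel β (n + 3)) :=
    isPartialPosSemidef_of_nonneg β x _ fun f hf => (hμ.momentFunctional_mul_self hf).1
  refine ⟨hpart, ?_⟩
  have hT := (posSemidef_of_isPartialPosSemidef hpart).1
  have hiso : ∀ f : ℝ[X], f.degree < (n + 2 : ℕ) →
      (momentFunctional (fillOne β x) (X * f * (X * f)) = 0 ↔ ∀ᵐ t ∂μ, t * f.eval t = 0) := by
    intro f hf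
    rw [(hμ.momentFunctional_mul_self (degree_X_mul_lt hf)).2]
    simp only [eval_mul, eval_X]
  by_cases hTd : (hankelTilde β (n + 2)).PosDef
  · left
    refine ⟨hTd, ?_⟩
    rw [hankelTilde_posDef_iff β x] at hTd
    rw [matTilde_posDef_iff β x]
    intro g hg0 hg hg1
    have hg' : g.degree < (n + 2 + 1 : ℕ) := hg.trans (by norm_cast; omega)
    obtain ⟨h1, h2⟩ := hμ.momentFunctional_mul_self hg'
    refine lt_of_le_of_ne h1 fun h => (hTd g hg0 hg).ne' ?_
    rw [hiso g hg]
    filter_upwards [h2.1 h.symm] with t ht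
    rw [ht, mul_zero]
  · right
    rw [ranksAgree_iff β x n hT]
    rw [hankelTilde_posDef_iff β x] at hTd
    push Not at hTd
    obtain ⟨f, hf0, hf, hle⟩ := hTd
    have hae := (hiso f hf).1 (le_antisymm hle
      ((hankelTilde_posSemidef_iff β x _).1 hT f hf))
    have hfn : f.natDegree < n + 2 := by
      rw [degree_eq_natDegree hf0] at hf; exact_mod_cast hf
    constructor
    -- Multiplying by a power of `X` raises the degree to `n + 1` and preserves vanishing almost
    -- everywhere.
    · have hd : (X ^ (n + 1 - f.natDegree) * f : ℝ[X]).degree < (n + 2 : ℕ) := by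
        rw [degree_mul, degree_X_pow, degree_eq_natDegree hf0]; norm_cast; omega
      refine ⟨X ^ (n + 1 - f.natDegree) * f, hd, ?_, ?_⟩
      · have : n + 1 = f.natDegree + (n + 1 - f.natDegree) := by omega
        nth_rw 2 [this]
        rw [coeff_X_pow_mul, coeff_natDegree]
        exact leadingCoeff_ne_zero.2 hf0
      · rw [hiso _ hd]
        filter_upwards [hae] with t ht
        rw [eval_mul, mul_left_comm, ht, mul_zero]
    -- Removing all factors `X` makes the constant term nonzero; the one factor `t` kept in the
    -- isotropy condition still accounts for the point `0`.
    · obtain ⟨q, hq, hqX⟩ := exists_eq_pow_rootMultiplicity_mul_and_not_dvd f hf0 0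
      rw [C_0, sub_zero] at hq hqX
      have hq0 : q ≠ 0 := fun h => hqX (h ▸ dvd_zero _)
      have hd : q.degree < (n + 2 : ℕ) := by
        refine lt_of_le_of_lt ?_ hf
        exact degree_le_of_dvd ⟨_, by rw [mul_comm]; exact hq⟩ hf0
      refine ⟨q, hd, fun h => hqX (X_dvd_iff.2 h), ?_⟩
      rw [hiso _ hd]
      filter_upwards [hae] with t ht
      rw [hq, eval_mul, eval_pow, eval_X] at ht
      rcases mul_eq_zero.1 ht with h | h
      · rw [h, zero_mul]
      · rcases mul_eq_zero.1 h with h | h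
        · rw [eq_zero_of_pow_eq_zero h, zero_mul]
        · rw [h, mul_zero]

end

/-- For `k = 2` the matrix is the single entry `β 0`; this is why the first alternative needs no
condition on it. -/
theorem matTilde_two_posDef {β : ℕ → ℝ} (hβ : 0 < β 0) : (matTilde β 2).PosDef := by
  rw [matTilde_posDef_iff β 0 0]
  intro g hg hgd hg1
  have hgC : g = C (g.coeff 0) := by
    apply eq_C_of_degree_le_zero
    have := eq_of_coeff_zero (n := 1) hgd hg1
    exact Order.lt_succ_iff.1 this
  have h0 : g.coeff 0 ≠ 0 := fun h => hg (by rw [hgC, h, C_0])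
  rw [hgC, ← C_mul, ← monomial_zero_left, momentFunctional_monomial, fillOne_of_ne _ _ (by omega)]
  exact mul_pos hβ (mul_self_pos.2 h0)

end HamburgerGap

theorem theorem4p1 (k : ℕ) (hk : 1 < k) (β : ℕ → ℝ) (hβ : 0 < β 0) :
    List.TFAE
      [∃ (x₀ : ℝ) (μ : MeasureTheory.Measure ℝ),
          HamburgerGap.IsRepresenting μ (HamburgerGap.fillOne β x₀) (2 * k),
        ∃ (x₀ : ℝ) (μ : MeasureTheory.Measure ℝ),
          HamburgerGap.IsRepresenting μ (HamburgerGap.fillOne β x₀) (2 * k) ∧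
            (HamburgerGap.IsAtomic μ (HamburgerGap.rankTilde β k) ∨
              HamburgerGap.IsAtomic μ (HamburgerGap.rankTilde β k + 1)),
        HamburgerGap.IsPartialPosSemidef (HamburgerGap.partialHankel β (k + 1)) ∧
          (((k = 2 ∧ (HamburgerGap.hankelTilde β k).PosDef) ∨
              (2 < k ∧ (HamburgerGap.hankelTilde β k).PosDef ∧
                (HamburgerGap.matTilde β k).PosDef)) ∨
            HamburgerGap.RanksAgree β k)] ∧
    ((∃ (x₀ : ℝ) (μ : MeasureTheory.Measure ℝ),
        HamburgerGap.IsRepresenting μ (HamburgerGap.fillOne β x₀) (2 * k)) →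
      ((¬ ∃ (x₀ : ℝ) (μ : MeasureTheory.Measure ℝ),
          HamburgerGap.IsRepresenting μ (HamburgerGap.fillOne β x₀) (2 * k) ∧
            HamburgerGap.IsAtomic μ (HamburgerGap.rankTilde β k)) ↔
        (HamburgerGap.RanksAgree β k ∧
          (HamburgerGap.hankelHat β k).rank < (HamburgerGap.matHat β k).rank))) := by
  -- With `k = n + 2` the truncated subtractions in the matrix sizes reduce by computation.
  obtain ⟨n, rfl⟩ : ∃ n, k = n + 2 := ⟨k - 2, by omega⟩
  have hcond : ((n + 2 = 2 ∧ (HamburgerGap.hankelTilde β (n + 2)).PosDef) ∨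
      (2 < n + 2 ∧ (HamburgerGap.hankelTilde β (n + 2)).PosDef ∧
        (HamburgerGap.matTilde β (n + 2)).PosDef)) ↔
      ((HamburgerGap.hankelTilde β (n + 2)).PosDef ∧
        (HamburgerGap.matTilde β (n + 2)).PosDef) := by
    rcases n with _ | n
    · simp [HamburgerGap.matTilde_two_posDef hβ]
    · simp
  rw [hcond]
  constructor
  · tfae_have 1 → 3 := by
      rintro ⟨x, μ, hμ⟩
      exact HamburgerGap.conditions_of_isRepresenting hμ
    tfae_have 3 → 2 := by
      rintro ⟨hpart, h⟩
      obtain ⟨hT, hG⟩ := HamburgerGap.posSemidef_of_isPartialPosSemidef hpart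
      rcases h with ⟨hTd, hGd⟩ | hR
      · obtain ⟨x, μ, h1, h2⟩ := HamburgerGap.exists_isAtomic_of_posDef hTd hG hGd
        exact ⟨x, μ, h1, Or.inl h2⟩
      · obtain ⟨x, μ, h1, h2⟩ := HamburgerGap.exists_isAtomic_of_ranksAgree hT hG hR
        exact ⟨x, μ, h1, h2.imp_right And.right⟩
    tfae_have 2 → 1 := by
      rintro ⟨x, μ, hμ, -⟩
      exact ⟨x, μ, hμ⟩
    tfae_finish
  · rintro ⟨x, μ, hμ⟩
    obtain ⟨hpart, h⟩ := HamburgerGap.conditions_of_isRepresenting hμ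
    obtain ⟨hT, hG⟩ := HamburgerGap.posSemidef_of_isPartialPosSemidef hpart
    constructor
    · intro hno
      rcases h with ⟨hTd, hGd⟩ | hR
      · exact absurd (HamburgerGap.exists_isAtomic_of_posDef hTd hG hGd) hno
      · obtain ⟨y, ν, h1, h2 | h2⟩ := HamburgerGap.exists_isAtomic_of_ranksAgree hT hG hR
        · exact absurd ⟨y, ν, h1, h2⟩ hno
        · exact ⟨hR, h2.1⟩
    · rintro ⟨hR, hlt⟩ ⟨y, ν, h1, h2⟩
      exact HamburgerGap.not_rank_lt_of_isAtomic hT hG hR h1 h2 hlt
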